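/- Let $d\in\mathbb N$, and let $v:\mathbb R^{2d}\to[0,\infty)$ be a submultiplicative weight: $v$ is continuous, not identically zero, $v(z_1+z_2)\le v(z_1)v(z_2)$, and $v(x,\omega)=v(-x,\omega)=v(x,-\omega)$. A measurable $m:\mathbb R^{2d}\to[0,\infty)$ is called $v$-moderate if there is $C>0$ with $m(z_1+z_2)\le C\,v(z_1)m(z_2)$ for all $z_1,z_2\in\mathbb R^{2d}$. Notation. For $z=(x,\omega)$ let $\pi(z)\psi(t)=e^{2\pi i\omega\cdot t}\psi(t-x)$, let $\varphi_0(t)=2^{d/4}e^{-\pi t\cdot t}$, and for $\psi\in L^2(\mathbb R^d)$ let $V_{\varphi_0}\psi(z)=\langle\psi,\pi(z)\varphi_0\rangle$. $M^1_v$ is the space of $\psi\in L^2(\mathbb R^d)$ with $\|\psi\|_{M^1_v}=\int_{\mathbb R^{2d}}|V_{\varphi_0}\psi(z)|v(z)\,dz<\infty$, and $(M^1_v)'$ is the space of bounded antilinear functionals on $M^1_v$. For $\psi\in(M^1_v)'$ put $V_{\varphi_0}\psi(z)=\langle\psi,\pi(z)\varphi_0\rangle_{(M^1_v)',M^1_v}$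 and $\|\psi\|_{M^{p,q}_m}=\|V_{\varphi_0}\psi\|_{L^{p,q}_m}\in[0,\infty]$, where $$\|F\|_{L^{p,q}_m}=\Big(\int_{\mathbb R^d}\Big(\int_{\mathbb R^d}|F(x,\omega)|^p m(x,\omega)^p\,dx\Big)^{q/p}d\omega\Big)^{1/q}$$ (essential suprema for infinite exponents); $M^{p,q}_m$ is the set of $\psi\in(M^1_v)'$ with $\|\psi\|_{M^{p,q}_m}<\infty$. An operator $T$ is in $\mathcal N(L^2,M^1_v)$ if it maps $L^2(\mathbb R^d)$ to $M^1_v$ and $T\eta=\sum_{n}\langle\eta,\xi_n\rangle\phi_n$ in $M^1_v$ for all $\eta\in L^2(\mathbb R^d)$, for some $\phi_n\in M^1_v$, $\xi_n\in L^2(\mathbb R^d)$ with $\sum_n\|\phi_n\|_{M^1_v}\|\xi_n\|_{L^2}<\infty$. If $S$ is bounded on $L^2(\mathbb R^d)$ and $S^*\in\mathcal N(L^2,M^1_v)$, then $S$ is extended to $(M^1_v)'\to L^2(\mathbb R^d)$ by $\langle S\psi,\eta\rangle_{L^2}=\langle\psi,S^*\eta\rangle_{(M^1_v)',M^1_v}$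 for all $\eta\in L^2(\mathbb R^d)$. For $a\in L^2(\mathbb R^{2d})$ the Weyl transform $L_a$ is the bounded operator on $L^2(\mathbb R^d)$ with $\langle L_a\phi,\psi\rangle=\langle a,W(\psi,\phi)\rangle$ for all $\phi,\psi\in L^2(\mathbb R^d)$, where $W(\psi,\phi)(x,\omega)=\int_{\mathbb R^d}\psi(x+t/2)\overline{\phi(x-t/2)}e^{-2\pi i\omega\cdot t}\,dt$. Finally $T_za(w)=a(w-z)$. **Theorem.** Let $0\ne a\in L^2(\mathbb R^{2d})$ with $(L_a)^*\in\mathcal N(L^2,M^1_v)$. Then $(L_{T_za})^*\in\mathcal N(L^2,M^1_v)$ for every $z\in\mathbb R^{2d}$, so that $L_{T_za}\psi\in L^2(\mathbb R^d)$ is defined for every $\psi\in(M^1_v)'$, and $z\mapsto L_{T_za}\psi$ is strongly measurable (up to a null set). Moreover, for every $v$-moderate weight $m$ there are constants $C_1,C_2>0$ such that for all $1\le p,q\le\infty$ and all $\psi\in(M^1_v)'$, as an inequality in $[0,\infty]$, $$C_1\|\psi\|_{M^{p,q}_m}\le\Big(\int_{\mathbb R^d}\Big(\int_{\mathbb R^d}\|L_{T_{(x,\omega)}a}\psi\|_{L^2}^p\,m(x,\omega)^p\,dx\Big)^{q/p}d\omega\Big)^{1/q}\le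 C_2\|\psi\|_{M^{p,q}_m}$$ (with essential suprema for infinite exponents). In particular, the middle expression is an equivalent norm on $M^{p,q}_m$ when $m\not\equiv 0$, and $\psi\in(M^1_v)'$ belongs to $M^{p,q}_m$ if and only if it is finite. -/

import Mathlib

namespace TFA

open MeasureTheory Filter Topology ComplexConjugate
open scoped ENNReal FourierTransform

noncomputable section

/-- The Euclidean space `ℝᵈ`; phase space `ℝ²ᵈ` is `E d × E d` with points `z = (x, ω)`. -/
abbrev E (d : ℕ) := EuclideanSpace ℝ (Fin d)

/-- The Hilbert space `L²(ℝᵈ)`. The bracket `⟨f, g⟩` in comments, linear in `f`, is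
`inner ℂ g f` here. -/
abbrev L2 (d : ℕ) := Lp ℂ 2 (volume : Measure (E d))

theorem aeeq_fourier {d : ℕ} (g : E d → ℂ) (hg : Integrable g) (hg2 : MemLp g 2) :
    𝓕 g =ᵐ[volume] (𝓕 (hg2.toLp g) : L2 d) := by
  have hc : Continuous (𝓕 g) := by
    have := VectorFourier.fourierIntegral_continuous (μ := (volume : Measure (E d)))
      Real.continuous_fourierChar (L := innerₗ (E d)) (by exact continuous_inner) hg
    exact this
  refine ae_eq_of_integral_contDiff_smul_eq hc.locallyIntegrable
    ((Lp.memLp _).locallyIntegrable (by norm_num)) ?_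
  intro φ hφ hs
  have h1 : ContDiff ℝ (⊤ : ℕ∞) (fun x => (φ x : ℂ)) := Complex.ofRealCLM.contDiff.comp hφ
  have h2 : HasCompactSupport (fun x => (φ x : ℂ)) := hs.comp_left (g := fun r : ℝ => (r : ℂ)) (by simp)
  let s : SchwartzMap (E d) ℂ := h2.toSchwartzMap h1
  have hsx : ∀ x, s x = (φ x : ℂ) := fun x => rfl
  have e1 : ∫ x, φ x • (𝓕 (hg2.toLp g) : L2 d) x = ∫ x, (𝓕 s) x • g x := by
    have := congrArg (fun T => T s) (Lp.fourier_toTemperedDistribution_eq (hg2.toLp g))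
    simp only [TemperedDistribution.fourier_apply, Lp.toTemperedDistribution_apply] at this
    calc _ = ∫ x, s x • (𝓕 (hg2.toLp g) : L2 d) x := by simp [hsx]
      _ = _ := this.symm
      _ = _ := by
        refine integral_congr_ae ?_
        filter_upwards [hg2.coeFn_toLp] with x hx
        rw [hx]
  rw [e1]
  have := VectorFourier.integral_fourierIntegral_smul_eq_flip (L := innerₗ (E d))
    (μ := volume) (ν := volume) Real.continuous_fourierChar (by exact continuous_inner) s.integrable hg
  have hfl : (innerₗ (E d)).flip = innerₗ (E d) := by
    ext x y; simp
  rw [hfl] at this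
  symm
  calc _ = _ := this
    _ = _ := by
      simp only [hsx]
      refine integral_congr_ae (Eventually.of_forall fun x => ?_)
      simp
      left; rfl

theorem lintegral_fourier_sq_le {d : ℕ} (g : E d → ℂ) (hg : Integrable g) :
    ∫⁻ w, ‖𝓕 g w‖ₑ ^ 2 ≤ ∫⁻ t, ‖g t‖ₑ ^ 2 := by
  by_cases h : ∫⁻ t, ‖g t‖ₑ ^ 2 = ∞
  · rw [h]; exact le_top
  have key : ∀ f : E d → ℂ, eLpNorm f 2 volume ^ 2 = ∫⁻ t, ‖f t‖ₑ ^ 2 := by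
    intro f
    have := eLpNorm_nnreal_pow_eq_lintegral (p := 2) (f := f) (μ := volume) (by norm_num)
    simpa using this
  have hg2 : MemLp g 2 := by
    refine ⟨hg.1, ?_⟩
    have := key g
    by_contra hh
    rw [not_lt_top_iff.1 hh] at this
    exact h (by rw [← this]; simp)
  rw [← key, ← key, eLpNorm_congr_ae (aeeq_fourier g hg hg2)]
  have e1 := Lp.enorm_def (𝓕 (hg2.toLp g) : L2 d)
  have e2 := Lp.enorm_toLp hg2
  rw [← e1, ← e2, ← ofReal_norm, ← ofReal_norm, Lp.norm_fourier_eq]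

/-- The cross-Wigner distribution
`W(ψ, φ)(x, ω) = ∫ ψ(x + t/2) conj(φ(x - t/2)) e^{-2πi ω·t} dt`. -/
def wigner {d : ℕ} (ψ φ : L2 d) (z : E d × E d) : ℂ :=
  ∫ t, ψ (z.1 + (1 / 2 : ℝ) • t) * conj (φ (z.1 - (1 / 2 : ℝ) • t)) *
    Complex.exp (-2 * Real.pi * Complex.I * (inner ℝ z.2 t : ℝ))

/-- The function `t ↦ ψ(x + t/2) conj(φ(x - t/2))`. -/
def ambig {d : ℕ} (ψ φ : L2 d) (x t : E d) : ℂ :=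
  ψ (x + (1 / 2 : ℝ) • t) * conj (φ (x - (1 / 2 : ℝ) • t))

theorem quasi_add {d : ℕ} (x : E d) :
    Measure.QuasiMeasurePreserving (fun t : E d => x + (1 / 2 : ℝ) • t) := by
  have h1 : Measure.QuasiMeasurePreserving (fun t : E d => (1 / 2 : ℝ) • t) :=
    Measure.quasiMeasurePreserving_smul volume (by norm_num)
  exact (measurePreserving_add_left volume x).quasiMeasurePreserving.comp h1


theorem quasi_sub {d : ℕ} (x : E d) :
    Measure.QuasiMeasurePreserving (fun t : E d => x - (1 / 2 : ℝ) • t) := by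
  have h1 : Measure.QuasiMeasurePreserving (fun t : E d => (1 / 2 : ℝ) • t) :=
    Measure.quasiMeasurePreserving_smul volume (by norm_num)
  exact (Measure.measurePreserving_sub_left volume x).quasiMeasurePreserving.comp h1

theorem memLp_half_add {d : ℕ} (ψ : L2 d) (x : E d) :
    MemLp (fun t => ψ (x + (1 / 2 : ℝ) • t)) 2 := by
  have hm : AEStronglyMeasurable (fun t => ψ (x + (1 / 2 : ℝ) • t)) volume :=
    ((Lp.stronglyMeasurable ψ).comp_measurable (by fun_prop)).aestronglyMeasurable
  rw [memLp_two_iff_integrable_sq_norm hm]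
  have h := (memLp_two_iff_integrable_sq_norm (Lp.memLp ψ).1).1 (Lp.memLp ψ)
  exact (h.comp_add_left x).comp_smul (R := (1 / 2 : ℝ)) (by norm_num)

theorem memLp_half_sub {d : ℕ} (ψ : L2 d) (x : E d) :
    MemLp (fun t => ψ (x - (1 / 2 : ℝ) • t)) 2 := by
  have hm : AEStronglyMeasurable (fun t => ψ (x - (1 / 2 : ℝ) • t)) volume :=
    ((Lp.stronglyMeasurable ψ).comp_measurable (by fun_prop)).aestronglyMeasurable
  rw [memLp_two_iff_integrable_sq_norm hm]
  have h := (memLp_two_iff_integrable_sq_norm (Lp.memLp ψ).1).1 (Lp.memLp ψ)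
  exact (h.comp_sub_left x).comp_smul (R := (1 / 2 : ℝ)) (by norm_num)

theorem integrable_ambig {d : ℕ} (ψ φ : L2 d) (x : E d) : Integrable (ambig ψ φ x) :=
  (memLp_half_add ψ x).integrable_mul (memLp_half_sub φ x).star

theorem wigner_eq_fourier {d : ℕ} (ψ φ : L2 d) (z : E d × E d) :
    wigner ψ φ z = 𝓕 (ambig ψ φ z.1) z.2 := by
  rw [Real.fourier_eq', wigner]
  refine integral_congr_ae (Eventually.of_forall fun t => ?_)
  simp only [ambig, smul_eq_mul]
  rw [mul_comm, real_inner_comm]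
  congr 2
  push_cast; ring

theorem lintegral_ambig {d : ℕ} (ψ φ : L2 d) :
    ∫⁻ x, ∫⁻ t, ‖ambig ψ φ x t‖ₑ ^ 2 = (‖ψ‖ₑ * ‖φ‖ₑ) ^ 2 := by
  have key : ∀ f : L2 d, ‖f‖ₑ ^ 2 = ∫⁻ t, ‖f t‖ₑ ^ 2 := by
    intro f
    have := eLpNorm_nnreal_pow_eq_lintegral (p := 2) (f := f) (μ := volume) (by norm_num)
    rw [Lp.enorm_def]
    simpa using this
  have hψ : Measurable fun t => ‖ψ t‖ₑ ^ 2 := (Lp.stronglyMeasurable ψ).measurable.enorm.pow_const 2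
  have hφ : Measurable fun t => ‖φ t‖ₑ ^ 2 := (Lp.stronglyMeasurable φ).measurable.enorm.pow_const 2
  have h0 : ∀ x t, ‖ambig ψ φ x t‖ₑ ^ 2
      = ‖ψ (x + (1 / 2 : ℝ) • t)‖ₑ ^ 2 * ‖φ (x - (1 / 2 : ℝ) • t)‖ₑ ^ 2 := by
    intro x t
    simp [ambig, enorm_mul, mul_pow]
  simp_rw [h0]
  rw [lintegral_lintegral_swap]
  swap
  · exact ((hψ.comp (by fun_prop)).mul (hφ.comp (by fun_prop))).aemeasurable
  have h1 : ∀ t : E d, ∫⁻ x, ‖ψ (x + (1 / 2 : ℝ) • t)‖ₑ ^ 2 * ‖φ (x - (1 / 2 : ℝ) • t)‖ₑ ^ 2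
      = ∫⁻ x, ‖ψ (x + t)‖ₑ ^ 2 * ‖φ x‖ₑ ^ 2 := by
    intro t
    rw [← lintegral_add_right_eq_self _ ((1 / 2 : ℝ) • t)]
    refine lintegral_congr fun x => ?_
    have : x + (1 / 2 : ℝ) • t + (1 / 2 : ℝ) • t = x + t := by
      rw [add_assoc, ← add_smul]; norm_num
    rw [this, add_sub_cancel_right]
  simp_rw [h1]
  rw [lintegral_lintegral_swap]
  swap
  · exact ((hψ.comp (by fun_prop)).mul (hφ.comp (by fun_prop))).aemeasurable
  have h2 : ∀ x : E d, ∫⁻ t, ‖ψ (x + t)‖ₑ ^ 2 * ‖φ x‖ₑ ^ 2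
      = (∫⁻ t, ‖ψ t‖ₑ ^ 2) * ‖φ x‖ₑ ^ 2 := by
    intro x
    have hm : Measurable fun t => ‖ψ (x + t)‖ₑ ^ 2 := hψ.comp (measurable_const_add x)
    rw [lintegral_mul_const _ hm,
      lintegral_add_left_eq_self (fun t => ‖ψ t‖ₑ ^ 2) x]
  simp_rw [h2]
  rw [lintegral_const_mul _ hφ, ← key, ← key, mul_pow]

theorem stronglyMeasurable_wigner {d : ℕ} (ψ φ : L2 d) : StronglyMeasurable (wigner ψ φ) := by
  unfold wigner
  have h1 : StronglyMeasurable (fun w : (E d × E d) × E d => ψ (w.1.1 + (1 / 2 : ℝ) • w.2)) :=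
    (Lp.stronglyMeasurable ψ).comp_measurable (by fun_prop)
  have h2 : StronglyMeasurable
      (fun w : (E d × E d) × E d => conj (φ (w.1.1 - (1 / 2 : ℝ) • w.2))) :=
    Complex.continuous_conj.comp_stronglyMeasurable
      ((Lp.stronglyMeasurable φ).comp_measurable (by fun_prop))
  have h3 : StronglyMeasurable (fun w : (E d × E d) × E d =>
      Complex.exp (-2 * Real.pi * Complex.I * (inner ℝ w.1.2 w.2 : ℝ))) := by
    apply Continuous.stronglyMeasurable
    fun_prop
  exact StronglyMeasurable.integral_prod_right ((h1.mul h2).mul h3)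

theorem eLpNorm_wigner_le {d : ℕ} (ψ φ : L2 d) :
    eLpNorm (wigner ψ φ) 2 volume ≤ ‖ψ‖ₑ * ‖φ‖ₑ := by
  have h := eLpNorm_nnreal_pow_eq_lintegral (p := 2) (f := wigner ψ φ) (μ := volume) (by norm_num)
  have h' : eLpNorm (wigner ψ φ) 2 volume ^ 2 = ∫⁻ z, ‖wigner ψ φ z‖ₑ ^ 2 := by simpa using h
  rw [← ENNReal.pow_le_pow_left_iff two_ne_zero, h', Measure.volume_eq_prod,
    lintegral_prod _ ((stronglyMeasurable_wigner ψ φ).measurable.enorm.pow_const 2).aemeasurable,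
    ← lintegral_ambig]
  refine lintegral_mono fun x => ?_
  simp_rw [wigner_eq_fourier]
  exact lintegral_fourier_sq_le _ (integrable_ambig ψ φ x)

theorem memLp_wigner {d : ℕ} (ψ φ : L2 d) : MemLp (wigner ψ φ) 2 :=
  ⟨(stronglyMeasurable_wigner ψ φ).aestronglyMeasurable,
    (eLpNorm_wigner_le ψ φ).trans_lt (ENNReal.mul_lt_top enorm_lt_top enorm_lt_top)⟩

/-- The cross-Wigner distribution as an element of `L²(ℝ²ᵈ)`. -/
def wignerL2 {d : ℕ} (ψ φ : L2 d) : Lp ℂ 2 (volume : Measure (E d × E d)) :=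
  (memLp_wigner ψ φ).toLp (wigner ψ φ)

theorem norm_wignerL2_le {d : ℕ} (ψ φ : L2 d) : ‖wignerL2 ψ φ‖ ≤ ‖ψ‖ * ‖φ‖ := by
  have h : ‖wignerL2 ψ φ‖ₑ ≤ ‖ψ‖ₑ * ‖φ‖ₑ := by
    rw [wignerL2, Lp.enorm_toLp]; exact eLpNorm_wigner_le ψ φ
  have := ENNReal.toReal_mono (ENNReal.mul_ne_top enorm_ne_top enorm_ne_top) h
  simpa [ENNReal.toReal_mul] using this

theorem integrable_wigner {d : ℕ} (ψ φ : L2 d) (z : E d × E d) :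
    Integrable (fun t => ψ (z.1 + (1 / 2 : ℝ) • t) * conj (φ (z.1 - (1 / 2 : ℝ) • t)) *
      Complex.exp (-2 * Real.pi * Complex.I * (inner ℝ z.2 t : ℝ))) := by
  refine (integrable_ambig ψ φ z.1).mul_bdd (c := 1) ?_ (Eventually.of_forall fun t => ?_)
  · exact (by fun_prop : Continuous _).aestronglyMeasurable
  · rw [Complex.norm_exp]; simp

theorem wigner_add_left {d : ℕ} (ψ₁ ψ₂ φ : L2 d) (z : E d × E d) :
    wigner (ψ₁ + ψ₂) φ z = wigner ψ₁ φ z + wigner ψ₂ φ z := by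
  unfold wigner
  rw [← integral_add (integrable_wigner ψ₁ φ z) (integrable_wigner ψ₂ φ z)]
  refine integral_congr_ae ?_
  filter_upwards [(quasi_add z.1).ae (Lp.coeFn_add ψ₁ ψ₂)] with t ht
  rw [ht]; simp only [Pi.add_apply]; ring

theorem wigner_add_right {d : ℕ} (ψ φ₁ φ₂ : L2 d) (z : E d × E d) :
    wigner ψ (φ₁ + φ₂) z = wigner ψ φ₁ z + wigner ψ φ₂ z := by
  unfold wigner
  rw [← integral_add (integrable_wigner ψ φ₁ z) (integrable_wigner ψ φ₂ z)]
  refine integral_congr_ae ?_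
  filter_upwards [(quasi_sub z.1).ae (Lp.coeFn_add φ₁ φ₂)] with t ht
  rw [ht]; simp only [Pi.add_apply, map_add]; ring

theorem wigner_smul_left {d : ℕ} (c : ℂ) (ψ φ : L2 d) (z : E d × E d) :
    wigner (c • ψ) φ z = c * wigner ψ φ z := by
  unfold wigner
  rw [← integral_const_mul]
  refine integral_congr_ae ?_
  filter_upwards [(quasi_add z.1).ae (Lp.coeFn_smul c ψ)] with t ht
  rw [ht]; simp only [Pi.smul_apply, smul_eq_mul]; ring

theorem wigner_smul_right {d : ℕ} (c : ℂ) (ψ φ : L2 d) (z : E d × E d) :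
    wigner ψ (c • φ) z = conj c * wigner ψ φ z := by
  unfold wigner
  rw [← integral_const_mul]
  refine integral_congr_ae ?_
  filter_upwards [(quasi_sub z.1).ae (Lp.coeFn_smul c φ)] with t ht
  rw [ht]; simp only [Pi.smul_apply, smul_eq_mul, map_mul]; ring

theorem wignerL2_add_left {d : ℕ} (ψ₁ ψ₂ φ : L2 d) :
    wignerL2 (ψ₁ + ψ₂) φ = wignerL2 ψ₁ φ + wignerL2 ψ₂ φ := by
  unfold wignerL2
  rw [← MemLp.toLp_add]
  exact MemLp.toLp_congr _ _ (Eventually.of_forall fun z => wigner_add_left ψ₁ ψ₂ φ z)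

theorem wignerL2_add_right {d : ℕ} (ψ φ₁ φ₂ : L2 d) :
    wignerL2 ψ (φ₁ + φ₂) = wignerL2 ψ φ₁ + wignerL2 ψ φ₂ := by
  unfold wignerL2
  rw [← MemLp.toLp_add]
  exact MemLp.toLp_congr _ _ (Eventually.of_forall fun z => wigner_add_right ψ φ₁ φ₂ z)

theorem wignerL2_smul_left {d : ℕ} (c : ℂ) (ψ φ : L2 d) :
    wignerL2 (c • ψ) φ = c • wignerL2 ψ φ := by
  unfold wignerL2
  rw [← MemLp.toLp_const_smul]
  exact MemLp.toLp_congr _ _ (Eventually.of_forall fun z => wigner_smul_left c ψ φ z)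

theorem wignerL2_smul_right {d : ℕ} (c : ℂ) (ψ φ : L2 d) :
    wignerL2 ψ (c • φ) = conj c • wignerL2 ψ φ := by
  unfold wignerL2
  rw [← MemLp.toLp_const_smul]
  exact MemLp.toLp_congr _ _ (Eventually.of_forall fun z => wigner_smul_right c ψ φ z)

/-- The bounded sesquilinear form `(φ, ψ) ↦ ⟨a, W(ψ, φ)⟩`, conjugate-linear in `φ` in Lean's
convention (the inner product `inner ℂ` is conjugate-linear in its first slot). -/
def weylForm {d : ℕ} (a : Lp ℂ 2 (volume : Measure (E d × E d))) :
    L2 d →L⋆[ℂ] L2 d →L[ℂ] ℂ :=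
  LinearMap.mkContinuous₂
    (LinearMap.mk₂'ₛₗ (starRingEnd ℂ) (RingHom.id ℂ)
      (fun φ ψ : L2 d => inner ℂ a (wignerL2 ψ φ))
      (fun φ₁ φ₂ ψ => by rw [wignerL2_add_right, inner_add_right])
      (fun c φ ψ => by rw [wignerL2_smul_right, inner_smul_right]; rfl)
      (fun φ ψ₁ ψ₂ => by rw [wignerL2_add_left, inner_add_right])
      (fun c φ ψ => by rw [wignerL2_smul_left, inner_smul_right]; rfl))
    ‖a‖ (fun φ ψ => by
      refine (norm_inner_le_norm a (wignerL2 ψ φ)).trans ?_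
      have := mul_le_mul_of_nonneg_left (norm_wignerL2_le ψ φ) (norm_nonneg a)
      calc _ ≤ _ := this
        _ = _ := by ring)

/-- The Weyl transform `L_a` of `a ∈ L²(ℝ²ᵈ)`: the bounded operator on `L²(ℝᵈ)` with
`⟨L_a φ, ψ⟩ = ⟨a, W(ψ, φ)⟩` for all `φ, ψ` (see `inner_weyl`). -/
def weyl {d : ℕ} (a : Lp ℂ 2 (volume : Measure (E d × E d))) : L2 d →L[ℂ] L2 d :=
  InnerProductSpace.continuousLinearMapOfBilin (weylForm a)

/-- The defining identity `⟨L_a φ, ψ⟩ = ⟨a, W(ψ, φ)⟩` (inner products linear in the first slot,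
that is, `⟨f, g⟩ = inner ℂ g f`). -/
theorem inner_weyl {d : ℕ} (a : Lp ℂ 2 (volume : Measure (E d × E d))) (φ ψ : L2 d) :
    inner ℂ ψ (weyl a φ) = inner ℂ (wignerL2 ψ φ) a := by
  have h : inner ℂ (weyl a φ) ψ = inner ℂ a (wignerL2 ψ φ) :=
    InnerProductSpace.continuousLinearMapOfBilin_apply (weylForm a) φ ψ
  rw [← inner_conj_symm, h, inner_conj_symm]

instance instIsAddHaarMeasurePhase (d : ℕ) :
    (volume : Measure (E d × E d)).IsAddHaarMeasure := by
  rw [Measure.volume_eq_prod]; infer_instance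

theorem memLp_tfShift {d : ℕ} (z : E d × E d) (ψ : L2 d) :
    MemLp (fun t => Complex.exp (2 * Real.pi * Complex.I * (inner ℝ z.2 t : ℝ)) * ψ (t - z.1)) 2 := by
  have h : MemLp (fun t => ψ (t - z.1)) 2 :=
    (Lp.memLp ψ).comp_measurePreserving (measurePreserving_sub_right volume z.1)
  refine h.of_le (((by fun_prop : Continuous _).aestronglyMeasurable).mul h.1)
    (Eventually.of_forall fun t => ?_)
  rw [norm_mul, Complex.norm_exp]; simp

/-- The time-frequency shift `π(x, ω)ψ(t) = e^{2πi ω·t} ψ(t - x)` on `L²(ℝᵈ)`. -/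
def tfShift {d : ℕ} (z : E d × E d) (ψ : L2 d) : L2 d :=
  (memLp_tfShift z ψ).toLp
    (fun t => Complex.exp (2 * Real.pi * Complex.I * (inner ℝ z.2 t : ℝ)) * ψ (t - z.1))

/-- The short-time Fourier transform `V_φ ψ(z) = ⟨ψ, π(z)φ⟩` of `ψ ∈ L²(ℝᵈ)`. -/
def stft {d : ℕ} (φ ψ : L2 d) (z : E d × E d) : ℂ := inner ℂ (tfShift z φ) ψ

/-- The normalized Gaussian `φ₀(t) = 2^{d/4} e^{-π t·t}`. -/
def gaussianFun (d : ℕ) (t : E d) : ℝ := (2 : ℝ) ^ (d / 4 : ℝ) * Real.exp (-Real.pi * ‖t‖ ^ 2)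

theorem integrable_gauss {d : ℕ} (b : ℝ) (hb : 0 < b) :
    Integrable (fun t : E d => Real.exp (-b * ‖t‖ ^ 2)) := by
  have := (GaussianFourier.integrable_cexp_neg_mul_sq_norm_add (V := E d) (b := b)
    (by simpa using hb) 0 0).re
  refine this.congr (Eventually.of_forall fun t => ?_)
  have e : (-(b : ℂ) * (‖t‖ : ℂ) ^ 2 + 0 * ((inner ℝ (0 : E d) t : ℝ) : ℂ))
      = ((-b * ‖t‖ ^ 2 : ℝ) : ℂ) := by push_cast; ring
  simp only [e]
  exact Complex.exp_ofReal_re _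

theorem memLp_gaussian (d : ℕ) : MemLp (fun t : E d => (gaussianFun d t : ℂ)) 2 := by
  have hm : AEStronglyMeasurable (fun t : E d => (gaussianFun d t : ℂ)) volume := by
    unfold gaussianFun
    exact (by fun_prop : Continuous _).aestronglyMeasurable
  rw [memLp_two_iff_integrable_sq_norm hm]
  refine ((integrable_gauss (d := d) (2 * Real.pi) (by positivity)).const_mul
    (((2 : ℝ) ^ (d / 4 : ℝ)) ^ 2)).congr (Eventually.of_forall fun t => ?_)
  simp only [gaussianFun, Complex.norm_real, Real.norm_eq_abs, sq_abs, mul_pow,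
    ← Real.exp_nat_mul]
  congr 2
  push_cast; ring

/-- The normalized Gaussian `φ₀` as an element of `L²(ℝᵈ)`. -/
def gaussian (d : ℕ) : L2 d := (memLp_gaussian d).toLp (fun t => (gaussianFun d t : ℂ))

/-- Submultiplicative weights on phase space: continuous, non-negative, not identically zero,
and even in `x` and in `ω` separately. -/
structure IsSubmultWeight {d : ℕ} (v : E d × E d → ℝ) : Prop where
  continuous : Continuous v
  nonneg : ∀ z, 0 ≤ v z
  ne_zero : ∃ z, v z ≠ 0
  submult : ∀ z₁ z₂, v (z₁ + z₂) ≤ v z₁ * v z₂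
  neg_fst : ∀ x ω, v (-x, ω) = v (x, ω)
  neg_snd : ∀ x ω, v (x, -ω) = v (x, ω)

/-- `m` is a (Lebesgue measurable, non-negative) `v`-moderate weight. -/
structure IsModerate {d : ℕ} (v m : E d × E d → ℝ) : Prop where
  aemeasurable : AEMeasurable m
  nonneg : ∀ z, 0 ≤ m z
  moderate : ∃ C : ℝ, 0 < C ∧ ∀ z₁ z₂, m (z₁ + z₂) ≤ C * v z₁ * m z₂

theorem IsSubmultWeight.one_le {d : ℕ} {v : E d × E d → ℝ} (hv : IsSubmultWeight v)
    (z : E d × E d) : 1 ≤ v z := by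
  obtain ⟨y, hy⟩ := hv.ne_zero
  have h0 : v 0 ≠ 0 := by
    intro h
    have := hv.submult y 0
    rw [add_zero, h, mul_zero] at this
    exact hy (le_antisymm this (hv.nonneg y))
  have h0' : 0 < v 0 := lt_of_le_of_ne (hv.nonneg 0) (Ne.symm h0)
  have h1 : 1 ≤ v 0 := by
    have := hv.submult 0 0
    rw [add_zero] at this
    nlinarith
  have h2 : v (-z) = v z := by
    obtain ⟨x, ω⟩ := z
    rw [Prod.neg_mk, hv.neg_fst, hv.neg_snd]
  have h3 := hv.submult z (-z)
  rw [add_neg_cancel, h2] at h3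
  nlinarith [hv.nonneg z]

theorem IsSubmultWeight.exp_growth {d : ℕ} {v : E d × E d → ℝ} (hv : IsSubmultWeight v) :
    ∃ B : ℝ, 0 ≤ B ∧ ∀ z, v z ≤ Real.exp B * Real.exp (B * ‖z‖) := by
  obtain ⟨K, hK⟩ := (isCompact_closedBall (0 : E d × E d) 1).exists_bound_of_continuousOn
    hv.continuous.continuousOn
  have hK' : ∀ z : E d × E d, ‖z‖ ≤ 1 → v z ≤ K := fun z hz =>
    (le_abs_self _).trans (hK z (by simpa using hz))
  have hK1 : 1 ≤ K := (hv.one_le 0).trans (hK' 0 (by simp))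
  have hpow : ∀ (n : ℕ) (z : E d × E d), v ((n + 1 : ℕ) • z) ≤ v z ^ (n + 1) := by
    intro n z
    induction n with
    | zero => simp
    | succ n ih =>
      rw [succ_nsmul, pow_succ]
      exact (hv.submult _ _).trans (mul_le_mul_of_nonneg_right ih (hv.nonneg z))
  refine ⟨Real.log K, Real.log_nonneg hK1, fun z => ?_⟩
  set n := ⌊‖z‖⌋₊ with hn
  have hnz : ‖z‖ < n + 1 := Nat.lt_floor_add_one _
  have hz : z = (n + 1 : ℕ) • (((n + 1 : ℕ) : ℝ)⁻¹ • z) := by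
    rw [← Nat.cast_smul_eq_nsmul ℝ, smul_smul, mul_inv_cancel₀ (by positivity), one_smul]
  have hsmall : ‖((n + 1 : ℕ) : ℝ)⁻¹ • z‖ ≤ 1 := by
    rw [norm_smul, norm_inv, Real.norm_natCast, inv_mul_le_iff₀ (by positivity)]
    push_cast; linarith
  calc v z = v ((n + 1 : ℕ) • (((n + 1 : ℕ) : ℝ)⁻¹ • z)) := by rw [← hz]
    _ ≤ v (((n + 1 : ℕ) : ℝ)⁻¹ • z) ^ (n + 1) := hpow n _
    _ ≤ K ^ (n + 1) := pow_le_pow_left₀ (hv.nonneg _) (hK' _ hsmall) _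
    _ = Real.exp (Real.log K * (n + 1)) := by
      rw [mul_comm, ← Nat.cast_succ, Real.exp_nat_mul, Real.exp_log (by linarith)]
    _ ≤ Real.exp (Real.log K) * Real.exp (Real.log K * ‖z‖) := by
      rw [← Real.exp_add]
      apply Real.exp_le_exp.2
      have : (n : ℝ) ≤ ‖z‖ := Nat.floor_le (norm_nonneg z)
      nlinarith [Real.log_nonneg hK1]

theorem stft_eq_integral {d : ℕ} (φ ψ : L2 d) (z : E d × E d) :
    stft φ ψ z = ∫ t, ψ t * conj (φ (t - z.1)) *
      Complex.exp (-2 * Real.pi * Complex.I * (inner ℝ z.2 t : ℝ)) := by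
  rw [stft, L2.inner_def]
  refine integral_congr_ae ?_
  filter_upwards [(memLp_tfShift z φ).coeFn_toLp] with t ht
  rw [tfShift, ht, RCLike.inner_apply, map_mul, ← Complex.exp_conj]
  simp only [map_mul, Complex.conj_ofReal, Complex.conj_I, map_ofNat]
  ring_nf

theorem stft_gaussian {d : ℕ} (z : E d × E d) :
    stft (gaussian d) (gaussian d) z
      = Complex.exp (-Real.pi * Complex.I * (inner ℝ z.2 z.1 : ℝ)) *
        (Real.exp (-(Real.pi / 2) * ‖z.1‖ ^ 2) * Real.exp (-(Real.pi / 2) * ‖z.2‖ ^ 2) : ℝ) := by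
  rw [stft_eq_integral]
  have hg := (memLp_gaussian d).coeFn_toLp
  have h1 : ∫ t, gaussian d t * conj (gaussian d (t - z.1)) *
      Complex.exp (-2 * Real.pi * Complex.I * (inner ℝ z.2 t : ℝ))
      = ∫ t, (gaussianFun d t : ℂ) * (gaussianFun d (t - z.1) : ℂ) *
      Complex.exp (-2 * Real.pi * Complex.I * (inner ℝ z.2 t : ℝ)) := by
    refine integral_congr_ae ?_
    filter_upwards [hg, (measurePreserving_sub_right volume z.1).quasiMeasurePreserving.ae hg]
      with t ht ht'
    rw [gaussian, ht, ht', Complex.conj_ofReal]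
  rw [h1, ← integral_add_right_eq_self _ ((1 / 2 : ℝ) • z.1)]
  have h2 : ∀ t : E d, (gaussianFun d (t + (1 / 2 : ℝ) • z.1) : ℂ) *
      (gaussianFun d (t + (1 / 2 : ℝ) • z.1 - z.1) : ℂ) *
      Complex.exp (-2 * Real.pi * Complex.I * (inner ℝ z.2 (t + (1 / 2 : ℝ) • z.1) : ℝ))
      = ((2 : ℂ) ^ (d / 2 : ℂ) * Complex.exp (-Real.pi * Complex.I * (inner ℝ z.2 z.1 : ℝ)) *
        Complex.exp (-(Real.pi / 2) * ‖z.1‖ ^ 2)) *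
        Complex.exp (-(2 * Real.pi : ℂ) * ‖t‖ ^ 2 +
          (-2 * Real.pi * Complex.I) * (inner ℝ z.2 t : ℝ)) := by
    intro t
    have e1 : ‖t + (1 / 2 : ℝ) • z.1‖ ^ 2 + ‖t + (1 / 2 : ℝ) • z.1 - z.1‖ ^ 2
        = 2 * ‖t‖ ^ 2 + ‖z.1‖ ^ 2 / 2 := by
      have : t + (1 / 2 : ℝ) • z.1 - z.1 = t - (1 / 2 : ℝ) • z.1 := by
        module
      rw [this, norm_add_sq_real, norm_sub_sq_real, norm_smul]
      norm_num; ring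
    have e2 : ((gaussianFun d (t + (1 / 2 : ℝ) • z.1) : ℂ) *
      (gaussianFun d (t + (1 / 2 : ℝ) • z.1 - z.1) : ℂ)) = (2 : ℂ) ^ (d / 2 : ℂ) *
        Complex.exp (-Real.pi * (2 * ‖t‖ ^ 2 + ‖z.1‖ ^ 2 / 2)) := by
      have : gaussianFun d (t + (1 / 2 : ℝ) • z.1) * gaussianFun d (t + (1 / 2 : ℝ) • z.1 - z.1)
          = (2 : ℝ) ^ (d / 2 : ℝ) * Real.exp (-Real.pi * (2 * ‖t‖ ^ 2 + ‖z.1‖ ^ 2 / 2)) := by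
        rw [← e1, gaussianFun, gaussianFun, mul_add, Real.exp_add]
        have : (2 : ℝ) ^ (d / 2 : ℝ) = (2 : ℝ) ^ (d / 4 : ℝ) * (2 : ℝ) ^ (d / 4 : ℝ) := by
          rw [← Real.rpow_add (by norm_num)]; congr 1; ring
        rw [this]; ring
      rw [← Complex.ofReal_mul, this, Complex.ofReal_mul, Complex.ofReal_cpow (by norm_num)]
      push_cast; rfl
    rw [e2, mul_assoc, ← Complex.exp_add, mul_assoc ((2 : ℂ) ^ (d / 2 : ℂ)), ← Complex.exp_add,
      mul_assoc ((2 : ℂ) ^ (d / 2 : ℂ)), ← Complex.exp_add, inner_add_right, inner_smul_right]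
    congr 2
    push_cast; ring
  simp_rw [h2]
  rw [integral_const_mul, GaussianFourier.integral_cexp_neg_mul_sq_norm_add
    (by simp [Real.pi_pos])]
  have e3 : (Real.pi / (2 * Real.pi) : ℂ) = ((1 / 2 : ℝ) : ℂ) := by
    have : (Real.pi : ℂ) ≠ 0 := by exact_mod_cast Real.pi_ne_zero
    push_cast; field_simp
  have e4 : (2 : ℂ) ^ (d / 2 : ℂ) * ((1 / 2 : ℝ) : ℂ) ^ (d / 2 : ℂ) = 1 := by
    have : (2 : ℝ) ^ (d / 2 : ℝ) * (1 / 2 : ℝ) ^ (d / 2 : ℝ) = 1 := by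
      rw [← Real.mul_rpow (by norm_num) (by norm_num)]; norm_num
    have h := congrArg (fun r : ℝ => (r : ℂ)) this
    simp only [Complex.ofReal_mul] at h
    rw [Complex.ofReal_cpow (by norm_num), Complex.ofReal_cpow (by norm_num)] at h
    push_cast at h ⊢
    exact h
  have e5 : ((-2 * Real.pi * Complex.I) ^ 2 * (‖z.2‖ : ℂ) ^ 2 / (4 * (2 * Real.pi)) : ℂ)
      = -(Real.pi / 2) * ‖z.2‖ ^ 2 := by
    have : (Real.pi : ℂ) ≠ 0 := by exact_mod_cast Real.pi_ne_zero
    field_simp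
    ring_nf
    simp [Complex.I_sq]
  rw [e5, finrank_euclideanSpace_fin, e3]
  push_cast
  push_cast at e4
  linear_combination (Complex.exp (-Real.pi * Complex.I * (inner ℝ z.2 z.1 : ℝ)) *
    Complex.exp (-(Real.pi / 2) * ‖z.1‖ ^ 2) * Complex.exp (-(Real.pi / 2) * ‖z.2‖ ^ 2)) * e4


theorem stft_add {d : ℕ} (φ ψ₁ ψ₂ : L2 d) (z : E d × E d) :
    stft φ (ψ₁ + ψ₂) z = stft φ ψ₁ z + stft φ ψ₂ z := inner_add_right _ _ _

theorem stft_smul {d : ℕ} (c : ℂ) (φ ψ : L2 d) (z : E d × E d) :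
    stft φ (c • ψ) z = c * stft φ ψ z := inner_smul_right _ _ _

/-- The space `M¹_v(ℝᵈ)` of those `ψ ∈ L²(ℝᵈ)` with `∫ |V_{φ₀}ψ(z)| v(z) dz < ∞`. -/
def M1 {d : ℕ} (v : E d × E d → ℝ) : Submodule ℂ (L2 d) where
  carrier := {ψ | Integrable (fun z => stft (gaussian d) ψ z * (v z : ℂ))}
  zero_mem' := by simp [stft]
  add_mem' := by
    intro ψ₁ ψ₂ h₁ h₂
    refine (h₁.add h₂).congr (Eventually.of_forall fun z => ?_)
    simp only [Pi.add_apply, stft_add]; ring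
  smul_mem' := by
    intro c ψ h
    refine (h.const_mul c).congr (Eventually.of_forall fun z => ?_)
    simp only [stft_smul]; ring

/-- The norm `∫ |V_{φ₀}ψ(z)| v(z) dz` of `M¹_v(ℝᵈ)`. -/
def M1norm {d : ℕ} (v : E d × E d → ℝ) (ψ : L2 d) : ℝ := ∫ z, ‖stft (gaussian d) ψ z‖ * v z

theorem gaussian_mem_M1 {d : ℕ} {v : E d × E d → ℝ} (hv : IsSubmultWeight v) :
    gaussian d ∈ M1 v := by
  change Integrable (fun z => stft (gaussian d) (gaussian d) z * (v z : ℂ))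
  obtain ⟨B, hB, hvB⟩ := hv.exp_growth
  have h1 : Integrable (fun x : E d => Real.exp (B ^ 2) * Real.exp (-(1 / 4 : ℝ) * ‖x‖ ^ 2)) :=
    (integrable_gauss (1 / 4 : ℝ) (by norm_num)).const_mul _
  have h2 := (h1.mul_prod h1).const_mul (Real.exp B)
  refine Integrable.mono' h2 ?_ (Eventually.of_forall fun z => ?_)
  · have hc := hv.continuous
    simp_rw [stft_gaussian]
    exact (by fun_prop : Continuous _).aestronglyMeasurable
  · have key : ∀ r : ℝ, 0 ≤ r → Real.exp (-(Real.pi / 2) * r ^ 2) * Real.exp (B * r)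
        ≤ Real.exp (B ^ 2) * Real.exp (-(1 / 4 : ℝ) * r ^ 2) := by
      intro r hr
      rw [← Real.exp_add, ← Real.exp_add]
      apply Real.exp_le_exp.2
      nlinarith [Real.pi_gt_three, sq_nonneg (B - r / 2), sq_nonneg r,
        mul_nonneg (sub_nonneg.2 Real.pi_gt_three.le) (sq_nonneg r)]
    have hz : ‖z‖ ≤ ‖z.1‖ + ‖z.2‖ := by
      rw [Prod.norm_def]
      exact max_le (by linarith [norm_nonneg z.2]) (by linarith [norm_nonneg z.1])
    have hv2 : v z ≤ Real.exp B * (Real.exp (B * ‖z.1‖) * Real.exp (B * ‖z.2‖)) := by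
      refine (hvB z).trans (mul_le_mul_of_nonneg_left ?_ (Real.exp_pos _).le)
      rw [← Real.exp_add]
      apply Real.exp_le_exp.2
      nlinarith
    have hn : ‖stft (gaussian d) (gaussian d) z‖
        = Real.exp (-(Real.pi / 2) * ‖z.1‖ ^ 2) * Real.exp (-(Real.pi / 2) * ‖z.2‖ ^ 2) := by
      rw [stft_gaussian, norm_mul, Complex.norm_exp, Complex.norm_real, Real.norm_of_nonneg
        (by positivity)]
      simp
    rw [norm_mul, hn, Complex.norm_real, Real.norm_of_nonneg (hv.nonneg z)]
    calc _ ≤ Real.exp (-(Real.pi / 2) * ‖z.1‖ ^ 2) * Real.exp (-(Real.pi / 2) * ‖z.2‖ ^ 2) *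
          (Real.exp B * (Real.exp (B * ‖z.1‖) * Real.exp (B * ‖z.2‖))) :=
          mul_le_mul_of_nonneg_left hv2 (by positivity)
      _ = Real.exp B * ((Real.exp (-(Real.pi / 2) * ‖z.1‖ ^ 2) * Real.exp (B * ‖z.1‖)) *
          (Real.exp (-(Real.pi / 2) * ‖z.2‖ ^ 2) * Real.exp (B * ‖z.2‖))) := by ring
      _ ≤ _ := by
        refine mul_le_mul_of_nonneg_left ?_ (Real.exp_pos _).le
        exact mul_le_mul (key _ (norm_nonneg _)) (key _ (norm_nonneg _)) (by positivity)
          (by positivity)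

theorem stft_tfShift {d : ℕ} (φ ψ : L2 d) (z w : E d × E d) :
    stft φ (tfShift z ψ) w
      = Complex.exp (-2 * Real.pi * Complex.I * (inner ℝ (w.2 - z.2) z.1 : ℝ)) *
        stft φ ψ (w - z) := by
  rw [stft_eq_integral, stft_eq_integral, ← integral_const_mul,
    ← integral_add_right_eq_self _ z.1]
  refine integral_congr_ae ?_
  filter_upwards [(measurePreserving_add_right volume z.1).quasiMeasurePreserving.ae
    (memLp_tfShift z ψ).coeFn_toLp] with t ht
  rw [tfShift, ht, add_sub_cancel_right]
  have e : t + z.1 - w.1 = t - (w - z).1 := by rw [Prod.fst_sub]; abel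
  rw [e, Prod.snd_sub]
  have e2 : Complex.exp (2 * Real.pi * Complex.I * (inner ℝ z.2 (t + z.1) : ℝ)) *
      Complex.exp (-2 * Real.pi * Complex.I * (inner ℝ w.2 (t + z.1) : ℝ))
      = Complex.exp (-2 * Real.pi * Complex.I * (inner ℝ (w.2 - z.2) z.1 : ℝ)) *
        Complex.exp (-2 * Real.pi * Complex.I * (inner ℝ (w.2 - z.2) t : ℝ)) := by
    rw [← Complex.exp_add, ← Complex.exp_add]
    congr 1
    simp only [inner_add_right, inner_sub_left]
    push_cast; ring
  linear_combination (ψ t * conj (φ (t - (w - z).1))) * e2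

theorem tfShift_mem_M1 {d : ℕ} {v : E d × E d → ℝ} (hv : IsSubmultWeight v) (z : E d × E d)
    {ψ : L2 d} (hψ : ψ ∈ M1 v) : tfShift z ψ ∈ M1 v := by
  change Integrable (fun w => stft (gaussian d) ψ w * (v w : ℂ)) at hψ
  change Integrable (fun w => stft (gaussian d) (tfShift z ψ) w * (v w : ℂ))
  have hc := hv.continuous
  have hpos : ∀ w, 0 < v w := fun w => lt_of_lt_of_le one_pos (hv.one_le w)
  have h1 := (hψ.comp_sub_right z).const_mul (v z : ℂ)
  refine h1.mono ?_ (Eventually.of_forall fun w => ?_)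
  · have h2 : AEStronglyMeasurable (fun w : E d × E d =>
        Complex.exp (-2 * Real.pi * Complex.I * (inner ℝ (w.2 - z.2) z.1 : ℝ)) *
          ((v (w - z) : ℂ)⁻¹ * (v w : ℂ))) volume := by
      have hne : ∀ w : E d × E d, (v (w - z) : ℂ) ≠ 0 := fun w => by
        exact_mod_cast (hpos (w - z)).ne'
      have hinv : Continuous fun w : E d × E d => (v (w - z) : ℂ)⁻¹ :=
        Continuous.inv₀ (by fun_prop) hne
      exact (by fun_prop : Continuous _).aestronglyMeasurable
    refine (h2.mul (hψ.comp_sub_right z).1).congr (Eventually.of_forall fun w => ?_)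
    have hne : (v (w - z) : ℂ) ≠ 0 := by exact_mod_cast (hpos (w - z)).ne'
    simp only [Pi.mul_apply, stft_tfShift]
    field_simp
  · rw [stft_tfShift]
    simp only [norm_mul, Complex.norm_exp, Complex.norm_real, Real.norm_of_nonneg (hv.nonneg _)]
    have h3 := hv.submult z (w - z)
    rw [add_sub_cancel] at h3
    have h4 := mul_le_mul_of_nonneg_left h3 (norm_nonneg (stft (gaussian d) ψ (w - z)))
    simp
    linarith

/-- The Gaussian as an element of `M¹_v(ℝᵈ)`. -/
def M1gaussian {d : ℕ} {v : E d × E d → ℝ} (hv : IsSubmultWeight v) : M1 v :=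
  ⟨gaussian d, gaussian_mem_M1 hv⟩

/-- The time-frequency shift `π(z)` acting on `M¹_v(ℝᵈ)`. -/
def M1shift {d : ℕ} {v : E d × E d → ℝ} (hv : IsSubmultWeight v) (z : E d × E d) (φ : M1 v) :
    M1 v :=
  ⟨tfShift z φ, tfShift_mem_M1 hv z φ.2⟩

/-- The dual `(M¹_v(ℝᵈ))'`: antilinear functionals on `M¹_v(ℝᵈ)` that are bounded for the norm
of `M¹_v(ℝᵈ)`; the value `ψ.1 φ` is the bracket `⟨ψ, φ⟩`. -/
def M1dual {d : ℕ} (v : E d × E d → ℝ) : Submodule ℂ (M1 v →ₗ⋆[ℂ] ℂ) where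
  carrier := {ψ | ∃ C : ℝ, ∀ φ : M1 v, ‖ψ φ‖ ≤ C * M1norm v φ}
  zero_mem' := ⟨0, fun φ => by simp⟩
  add_mem' := by
    rintro ψ₁ ψ₂ ⟨C₁, h₁⟩ ⟨C₂, h₂⟩
    refine ⟨C₁ + C₂, fun φ => ?_⟩
    rw [LinearMap.add_apply, add_mul]
    exact (norm_add_le _ _).trans (add_le_add (h₁ φ) (h₂ φ))
  smul_mem' := by
    rintro c ψ ⟨C, h⟩
    refine ⟨‖c‖ * C, fun φ => ?_⟩
    rw [LinearMap.smul_apply, norm_smul, mul_assoc]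
    exact mul_le_mul_of_nonneg_left (h φ) (norm_nonneg c)

/-- The short-time Fourier transform `V_φ ψ(z) = ⟨ψ, π(z)φ⟩` of `ψ ∈ (M¹_v)'` with window
`φ ∈ M¹_v`. -/
def dualStft {d : ℕ} {v : E d × E d → ℝ} (hv : IsSubmultWeight v) (φ : M1 v) (ψ : M1dual v)
    (z : E d × E d) : ℂ :=
  ψ.1 (M1shift hv z φ)

/-- The weighted mixed norm
`‖F‖_{L^{p,q}_m} = (∫ (∫ |F(x, ω)|^p m(x, ω)^p dx)^{q/p} dω)^{1/q} ∈ [0, ∞]`, with essential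
suprema for infinite exponents. -/
def mixedNorm {d : ℕ} (p q : ℝ≥0∞) (m : E d × E d → ℝ) (F : E d × E d → ℝ) : ℝ≥0∞ :=
  eLpNorm (fun ω => eLpNorm (fun x => F (x, ω) * m (x, ω)) p volume) q volume

/-- The modulation space norm `‖ψ‖_{M^{p,q}_m} = ‖V_{φ₀}ψ‖_{L^{p,q}_m} ∈ [0, ∞]`; the space
`M^{p,q}_m(ℝᵈ)` consists of the `ψ ∈ (M¹_v)'` for which it is finite. -/
def modNorm {d : ℕ} {v : E d × E d → ℝ} (hv : IsSubmultWeight v) (p q : ℝ≥0∞)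
    (m : E d × E d → ℝ) (ψ : M1dual v) : ℝ≥0∞ :=
  mixedNorm p q m (fun z => ‖dualStft hv (M1gaussian hv) ψ z‖)

/-- `T ∈ 𝒩(L², M¹_v)`: `T` maps `L²` to `M¹_v` and `T = ∑ φₙ ⊗ ξₙ`, where
`(φ ⊗ ξ)η = ⟨η, ξ⟩φ`, with `∑ ‖φₙ‖_{M¹_v} ‖ξₙ‖_{L²} < ∞`, the series for `T η` converging in the
norm of `M¹_v`. -/
def IsNuclear {d : ℕ} (v : E d × E d → ℝ) (T : L2 d →L[ℂ] L2 d) : Prop :=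
  ∃ (φ : ℕ → M1 v) (ξ : ℕ → L2 d), Summable (fun n => M1norm v (φ n) * ‖ξ n‖) ∧
    ∀ η : L2 d, T η ∈ M1 v ∧
      Tendsto (fun N => M1norm v (T η - ∑ n ∈ Finset.range N, inner ℂ (ξ n) η • (φ n : L2 d)))
        atTop (𝓝 0)

theorem IsNuclear.mem {d : ℕ} {v : E d × E d → ℝ} {T : L2 d →L[ℂ] L2 d} (hT : IsNuclear v T)
    (η : L2 d) : T η ∈ M1 v := by
  obtain ⟨φ, ξ, -, h⟩ := hT
  exact (h η).1

theorem integrable_M1 {d : ℕ} {v : E d × E d → ℝ} (hv : IsSubmultWeight v) {ψ : L2 d}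
    (hψ : ψ ∈ M1 v) : Integrable (fun z => ‖stft (gaussian d) ψ z‖ * v z) := by
  refine (Integrable.norm hψ).congr (Eventually.of_forall fun z => ?_)
  simp [abs_of_nonneg (hv.nonneg z)]

theorem M1norm_nonneg {d : ℕ} {v : E d × E d → ℝ} (hv : IsSubmultWeight v) (ψ : L2 d) :
    0 ≤ M1norm v ψ :=
  integral_nonneg fun z => mul_nonneg (norm_nonneg _) (hv.nonneg z)

theorem M1norm_add_le {d : ℕ} {v : E d × E d → ℝ} (hv : IsSubmultWeight v) {ψ₁ ψ₂ : L2 d}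
    (h₁ : ψ₁ ∈ M1 v) (h₂ : ψ₂ ∈ M1 v) : M1norm v (ψ₁ + ψ₂) ≤ M1norm v ψ₁ + M1norm v ψ₂ := by
  unfold M1norm
  rw [← integral_add (integrable_M1 hv h₁) (integrable_M1 hv h₂)]
  refine integral_mono (integrable_M1 hv ((M1 v).add_mem h₁ h₂))
    ((integrable_M1 hv h₁).add (integrable_M1 hv h₂)) fun z => ?_
  simp only [stft_add, ← add_mul]
  exact mul_le_mul_of_nonneg_right (norm_add_le _ _) (hv.nonneg z)

theorem M1norm_smul {d : ℕ} (v : E d × E d → ℝ) (c : ℂ) (ψ : L2 d) :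
    M1norm v (c • ψ) = ‖c‖ * M1norm v ψ := by
  unfold M1norm
  rw [← integral_const_mul]
  simp only [stft_smul, norm_mul, mul_assoc]

theorem IsNuclear.bound {d : ℕ} {v : E d × E d → ℝ} (hv : IsSubmultWeight v)
    {T : L2 d →L[ℂ] L2 d} (hT : IsNuclear v T) :
    ∃ C : ℝ, 0 ≤ C ∧ ∀ η, M1norm v (T η) ≤ C * ‖η‖ := by
  obtain ⟨φ, ξ, hs, h⟩ := hT
  have hnn : ∀ n, 0 ≤ M1norm v (φ n) * ‖ξ n‖ := fun n =>
    mul_nonneg (M1norm_nonneg hv _) (norm_nonneg _)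
  refine ⟨∑' n, M1norm v (φ n) * ‖ξ n‖, tsum_nonneg hnn, fun η => ?_⟩
  have hsum : ∀ N, (∑ n ∈ Finset.range N, inner ℂ (ξ n) η • (φ n : L2 d)) ∈ M1 v ∧
      M1norm v (∑ n ∈ Finset.range N, inner ℂ (ξ n) η • (φ n : L2 d))
        ≤ (∑ n ∈ Finset.range N, M1norm v (φ n) * ‖ξ n‖) * ‖η‖ := by
    intro N
    induction N with
    | zero => simp [M1norm, stft]
    | succ N ih =>
      rw [Finset.sum_range_succ, Finset.sum_range_succ]
      have hm : inner ℂ (ξ N) η • (φ N : L2 d) ∈ M1 v := (M1 v).smul_mem _ (φ N).2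
      refine ⟨(M1 v).add_mem ih.1 hm, (M1norm_add_le hv ih.1 hm).trans ?_⟩
      rw [add_mul, M1norm_smul]
      refine add_le_add ih.2 ?_
      have := mul_le_mul_of_nonneg_right (norm_inner_le_norm (𝕜 := ℂ) (ξ N) η)
        (M1norm_nonneg hv (φ N))
      calc _ ≤ _ := this
        _ = _ := by ring
  have hN : ∀ N, M1norm v (T η) ≤
      M1norm v (T η - ∑ n ∈ Finset.range N, inner ℂ (ξ n) η • (φ n : L2 d))
        + (∑' n, M1norm v (φ n) * ‖ξ n‖) * ‖η‖ := by
    intro N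
    have h1 := M1norm_add_le hv ((M1 v).sub_mem (h η).1 (hsum N).1) (hsum N).1
    rw [sub_add_cancel] at h1
    have h2 := mul_le_mul_of_nonneg_right (hs.sum_le_tsum (Finset.range N) fun n _ => hnn n)
      (norm_nonneg η)
    linarith [(hsum N).2]
  have hlim := (h η).2.add_const ((∑' n, M1norm v (φ n) * ‖ξ n‖) * ‖η‖)
  rw [zero_add] at hlim
  exact ge_of_tendsto' hlim hN

theorem M1dual_comp_bound {d : ℕ} {v : E d × E d → ℝ} (hv : IsSubmultWeight v)
    {T : L2 d →L[ℂ] L2 d} (hT : IsNuclear v T) (ψ : M1dual v) :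
    ∃ C : ℝ, ∀ η, ‖conj (ψ.1 ⟨T η, hT.mem η⟩)‖ ≤ C * ‖η‖ := by
  obtain ⟨C, hC⟩ := ψ.2
  obtain ⟨D, hD, hDb⟩ := hT.bound hv
  refine ⟨|C| * D, fun η => ?_⟩
  rw [RCLike.norm_conj]
  refine (hC _).trans ((mul_le_mul_of_nonneg_right (le_abs_self C)
    (M1norm_nonneg hv _)).trans ?_)
  rw [mul_assoc]
  exact mul_le_mul_of_nonneg_left (hDb η) (abs_nonneg C)

/-- The linear functional `η ↦ conj ⟨ψ, T η⟩` on `L²(ℝᵈ)`. -/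
def conjPairing {d : ℕ} {v : E d × E d → ℝ} {T : L2 d →L[ℂ] L2 d} (hT : IsNuclear v T)
    (ψ : M1dual v) : L2 d →ₗ[ℂ] ℂ where
  toFun η := conj (ψ.1 ⟨T η, hT.mem η⟩)
  map_add' η₁ η₂ := by
    have h : (⟨T (η₁ + η₂), hT.mem (η₁ + η₂)⟩ : M1 v) = ⟨T η₁, hT.mem η₁⟩ + ⟨T η₂, hT.mem η₂⟩ :=
      Subtype.ext (map_add T η₁ η₂)
    rw [h, map_add, map_add]
  map_smul' c η := by
    have h : (⟨T (c • η), hT.mem (c • η)⟩ : M1 v) = c • ⟨T η, hT.mem η⟩ :=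
      Subtype.ext (map_smul T c η)
    rw [h, LinearMap.map_smulₛₗ, smul_eq_mul, map_mul, Complex.conj_conj]
    rfl

/-- The adjoint `(M¹_v)' → L²` of a nuclear `T : L² → M¹_v`, that is, the element of `L²` with
`⟨dualAdjoint ψ, η⟩ = ⟨ψ, T η⟩` for all `η` (see `inner_dualAdjoint`). -/
def dualAdjoint {d : ℕ} {v : E d × E d → ℝ} (hv : IsSubmultWeight v) {T : L2 d →L[ℂ] L2 d}
    (hT : IsNuclear v T) (ψ : M1dual v) : L2 d :=
  (InnerProductSpace.toDual ℂ (L2 d)).symm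
    ((conjPairing hT ψ).mkContinuousOfExistsBound (M1dual_comp_bound hv hT ψ))

theorem inner_dualAdjoint {d : ℕ} {v : E d × E d → ℝ} (hv : IsSubmultWeight v)
    {T : L2 d →L[ℂ] L2 d} (hT : IsNuclear v T) (ψ : M1dual v) (η : L2 d) :
    inner ℂ η (dualAdjoint hv hT ψ) = ψ.1 ⟨T η, hT.mem η⟩ := by
  have h : inner ℂ (dualAdjoint hv hT ψ) η = conj (ψ.1 ⟨T η, hT.mem η⟩) :=
    InnerProductSpace.toDual_symm_apply
  rw [← inner_conj_symm, h, Complex.conj_conj]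

/-- The extension to `(M¹_v)'` of an operator `S` on `L²` with `S* ∈ 𝒩(L², M¹_v)`, given by
`⟨S ψ, η⟩ = ⟨ψ, S* η⟩` for `ψ ∈ (M¹_v)'` and `η ∈ L²`. -/
def extend {d : ℕ} {v : E d × E d → ℝ} (hv : IsSubmultWeight v) (S : L2 d →L[ℂ] L2 d)
    (hS : IsNuclear v (ContinuousLinearMap.adjoint S)) (ψ : M1dual v) : L2 d :=
  dualAdjoint hv hS ψ

/-- The translation `T_z a(w) = a(w - z)` on `L²(ℝ²ᵈ)`. -/
def translate {d : ℕ} (z : E d × E d) (a : Lp ℂ 2 (volume : Measure (E d × E d))) :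
    Lp ℂ 2 (volume : Measure (E d × E d)) :=
  Lp.compMeasurePreserving (fun w => w - z) (measurePreserving_sub_right volume z) a

end

end TFA

namespace TFA

open MeasureTheory Filter Topology ComplexConjugate
open scoped ENNReal FourierTransform

noncomputable section

/-! Conjugation by time-frequency shifts translates the Weyl symbol: L_{T_z a} = π(z) L_a π(z)*. A
nuclear decomposition ∑ φₙ ⊗ ξₙ of (L_a)* therefore turns into the decomposition ∑ π(z)φₙ ⊗ π(z)ξₙ
of (L_{T_z a})*, and by submultiplicativity π(z) enlarges `M¹_v` norms by at most the factor v(z).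
Applying ψ termwise gives L_{T_z a}ψ = ∑ V_{φₙ}ψ(z) π(z)ξₙ, a series in L² whose partial sums are
measurable in z.

Upper bound. The triangle inequality leaves ∑ ‖ξₙ‖ |V_{φₙ}ψ(z)|. A change of window bounds
|V_{φₙ}ψ(z)| by ∫ |V_{φ₀}φₙ(w - z)| |V_{φ₀}ψ(w)| dw, so |V_{φ₀}ψ| is integrated against the single
kernel ∑ ‖ξₙ‖ |V_{φ₀}φₙ|. Its L¹_v norm is ∑ ‖ξₙ‖ ‖φₙ‖_{M¹_v} < ∞, and the weighted Young inequality
for mixed norms finishes (`mixedENorm_young`). The constant there does not depend on p and q.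

Lower bound. The Weyl transform is injective (`weyl_ne_zero`), so some φ₁ = (L_a)*η in `M¹_v` is
nonzero. Covariance gives ⟨L_{T_z a}ψ, π(z)η⟩ = ⟨ψ, π(z)φ₁⟩ = V_{φ₁}ψ(z), hence |V_{φ₁}ψ(z)| ≤ ‖η‖
‖L_{T_z a}ψ‖. Changing the window from φ₁ back to φ₀ and using Young again recovers the modulation
norm.

Both changes of window rest on the reproducing formula on (M¹_v)' (`reproducing_formula`). The map φ
↦ V_{φ₀}φ · v embeds `M¹_v` isometrically in L¹, Hahn–Banach extends ψ to L¹, and the formula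
becomes a Bochner integral identity in L¹, checked by Fubini and Moyal's identity. Working in L¹
makes the completeness of `M¹_v` unnecessary. -/

/-! ### Minkowski's integral inequality -/

theorem measurable_eLpNorm_prod {α β : Type*} [MeasurableSpace α] [MeasurableSpace β]
    {μ : Measure α} [SFinite μ] {f : α → β → ℝ≥0∞} (hf : Measurable (Function.uncurry f))
    {p : ℝ≥0∞} (hp : 1 ≤ p) : Measurable (fun y => eLpNorm (fun x => f x y) p μ) := by
  have hp0 : p ≠ 0 := (zero_lt_one.trans_le hp).ne'
  by_cases hpt : p = ∞
  · subst hpt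
    refine measurable_of_Ioi fun c => ?_
    -- The essential supremum of a slice exceeds c exactly when the slice of {f > c} has positive
    -- measure, and measures of slices are measurable.
    have h1 : (fun y => eLpNorm (fun x => f x y) ∞ μ) ⁻¹' Set.Ioi c
        = {y | μ ((fun x => (x, y)) ⁻¹' {w | c < f w.1 w.2}) ≠ 0} := by
      ext y
      simp only [Set.mem_preimage, Set.mem_Ioi, Set.mem_ofPred_eq, ne_eq]
      rw [← not_le, not_iff_not, eLpNorm_exponent_top]
      change essSup (fun x => ‖f x y‖ₑ) μ ≤ c ↔ _
      constructor
      · intro h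
        have h2 : ∀ᵐ x ∂μ, f x y ≤ c := by
          filter_upwards [ae_le_essSup (μ := μ) (f := fun x => ‖f x y‖ₑ)] with x hx
          exact hx.trans h
        rw [ae_iff] at h2
        simpa using h2
      · intro h
        refine essSup_le_of_ae_le c ?_
        rw [Filter.EventuallyLE, ae_iff]
        simpa using h
    rw [h1]
    have h2 : MeasurableSet {w : α × β | c < f w.1 w.2} := measurableSet_lt measurable_const hf
    exact (measurable_measure_prodMk_right h2) (measurableSet_singleton 0).compl
  · simp_rw [eLpNorm_eq_lintegral_rpow_enorm_toReal hp0 hpt]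
    refine Measurable.pow_const ?_ _
    exact Measurable.lintegral_prod_left' (f := fun w : α × β => ‖f w.1 w.2‖ₑ ^ p.toReal)
      (hf.pow_const _)

/-- With N(y) the L^r norm of f(·, y) and K = ∫ N, split f = (f N^{-1/s}) · N^{1/s} and apply Hölder
in y. The second factor contributes K^{r/s}; integrating the r-th power of the first over x gives
N^r N^{-r/s} = N, since r/s = r - 1. The total is K · K^{r/s} = K^r, with no division by the left
side, which may be infinite. -/
theorem lintegral_rpow_lintegral_le {α β : Type*} [MeasurableSpace α] [MeasurableSpace β]
    {μ : Measure α} [SFinite μ] {ν : Measure β} [SFinite ν] {f : α → β → ℝ≥0∞}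
    (hf : Measurable (Function.uncurry f)) {r s : ℝ} (hrs : r.HolderConjugate s) :
    ∫⁻ x, (∫⁻ y, f x y ∂ν) ^ r ∂μ ≤ (∫⁻ y, (∫⁻ x, f x y ^ r ∂μ) ^ (1 / r) ∂ν) ^ r := by
  have hr0 : 0 < r := hrs.pos
  have hs0 : 0 < s := hrs.symm.pos
  set N : β → ℝ≥0∞ := fun y => (∫⁻ x, f x y ^ r ∂μ) ^ (1 / r) with hN
  have hNm : Measurable N := Measurable.pow_const
    (Measurable.lintegral_prod_left' (f := fun w : α × β => f w.1 w.2 ^ r) (hf.pow_const _)) _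
  set K := ∫⁻ y, N y ∂ν with hK
  by_cases hKt : K = ∞
  · rw [hKt, ENNReal.top_rpow_of_pos hr0]; exact le_top
  have hNr : ∀ y, N y ^ r = ∫⁻ x, f x y ^ r ∂μ := fun y => by
    rw [hN, ← ENNReal.rpow_mul, one_div_mul_cancel hr0.ne', ENNReal.rpow_one]
  set g : α → β → ℝ≥0∞ := fun x y => f x y * N y ^ (-(1 / s)) with hg
  have hgm : Measurable (Function.uncurry g) :=
    hf.mul ((hNm.comp measurable_snd).pow_const _)
  -- The splitting can fail only where N is 0 or ∞. If N(y) = 0 then f(·, y) vanishes a.e., and N =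
  -- ∞ is a null event because K < ∞.
  have h1 : ∀ᵐ y ∂ν, ∀ᵐ x ∂μ, f x y = g x y * N y ^ (1 / s) := by
    filter_upwards [ae_lt_top hNm hKt] with y hy
    by_cases h0 : N y = 0
    · have h2 : ∫⁻ x, f x y ^ r ∂μ = 0 := by rw [← hNr, h0, ENNReal.zero_rpow_of_pos hr0]
      have h3 : Measurable fun x => f x y ^ r :=
        (hf.comp (measurable_prodMk_right (y := y))).pow_const r
      rw [lintegral_eq_zero_iff h3] at h2
      filter_upwards [h2] with x hx
      have h4 : f x y = 0 := by simpa [ENNReal.rpow_eq_zero_iff, hr0, hr0.not_gt] using hx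
      simp [hg, h4]
    · refine Eventually.of_forall fun x => ?_
      rw [hg]
      simp only
      rw [mul_assoc, ← ENNReal.rpow_add _ _ h0 hy.ne, neg_add_cancel, ENNReal.rpow_zero, mul_one]
  have h2 : ∀ᵐ x ∂μ, ∀ᵐ y ∂ν, f x y = g x y * N y ^ (1 / s) := by
    rw [Measure.ae_ae_comm]
    · exact h1
    · exact measurableSet_eq_fun hf (hgm.mul ((hNm.comp measurable_snd).pow_const _))
  have h3 : ∀ᵐ x ∂μ, (∫⁻ y, f x y ∂ν) ^ r ≤ (∫⁻ y, g x y ^ r ∂ν) * K ^ (r / s) := by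
    filter_upwards [h2] with x hx
    rw [lintegral_congr_ae hx]
    have h4 := ENNReal.lintegral_mul_le_Lp_mul_Lq ν hrs
      (f := fun y => g x y) (g := fun y => N y ^ (1 / s))
      (hgm.comp measurable_prodMk_left).aemeasurable (hNm.pow_const _).aemeasurable
    have h5 := ENNReal.rpow_le_rpow h4 hr0.le
    refine h5.trans (le_of_eq ?_)
    rw [ENNReal.mul_rpow_of_nonneg _ _ hr0.le, ← ENNReal.rpow_mul, one_div_mul_cancel hr0.ne',
      ENNReal.rpow_one, ← ENNReal.rpow_mul]
    congr 2
    · refine lintegral_congr fun y => ?_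
      rw [← ENNReal.rpow_mul, one_div_mul_cancel hs0.ne', ENNReal.rpow_one]
    · ring
  refine (lintegral_mono_ae h3).trans ?_
  have hgr : Measurable fun w : α × β => g w.1 w.2 ^ r := hgm.pow_const r
  rw [lintegral_mul_const _ hgr.lintegral_prod_right', lintegral_lintegral_swap hgr.aemeasurable]
  have h6 : ∀ y, ∫⁻ x, g x y ^ r ∂μ ≤ N y := by
    intro y
    have e : ∀ x, g x y ^ r = f x y ^ r * N y ^ (-(r / s)) := fun x => by
      rw [hg]; simp only
      rw [ENNReal.mul_rpow_of_nonneg _ _ hr0.le, ← ENNReal.rpow_mul]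
      congr 2; ring
    simp_rw [e]
    have hfy : Measurable fun x => f x y ^ r :=
      (hf.comp (measurable_prodMk_right (y := y))).pow_const r
    rw [lintegral_mul_const _ hfy, ← hNr]
    have h7 : -(r / s) = 1 - r := by
      have := hrs.sub_one_mul_conj
      have := hrs.inv_add_inv_eq_one
      field_simp at this ⊢
      linarith
    rw [h7]
    by_cases h0 : N y = 0
    · rw [h0, ENNReal.zero_rpow_of_pos hr0, zero_mul]
    by_cases ht : N y = ∞
    · rw [ht]; exact le_top
    rw [← ENNReal.rpow_add _ _ h0 ht]
    simp
  have h8 : (1 : ℝ) + r / s = r := by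
    have := hrs.inv_add_inv_eq_one
    field_simp at this ⊢
    linarith
  calc _ ≤ K * K ^ (r / s) := mul_le_mul_left (lintegral_mono h6) _
    _ = K ^ (1 : ℝ) * K ^ (r / s) := by rw [ENNReal.rpow_one]
    _ = K ^ r := by rw [← ENNReal.rpow_add_of_nonneg _ _ zero_le_one (by positivity), h8]

/-- Minkowski's integral inequality. -/
theorem eLpNorm_lintegral_le {α β : Type*} [MeasurableSpace α] [MeasurableSpace β]
    {μ : Measure α} [SFinite μ] {ν : Measure β} [SFinite ν] {f : α → β → ℝ≥0∞}
    (hf : Measurable (Function.uncurry f)) {p : ℝ≥0∞} (hp : 1 ≤ p) :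
    eLpNorm (fun x => ∫⁻ y, f x y ∂ν) p μ ≤ ∫⁻ y, eLpNorm (fun x => f x y) p μ ∂ν := by
  have hp0 : p ≠ 0 := (zero_lt_one.trans_le hp).ne'
  by_cases hpt : p = ∞
  · subst hpt
    have hm := measurable_eLpNorm_prod (μ := μ) hf le_top
    have h1 : ∀ᵐ x ∂μ, ∀ᵐ y ∂ν, f x y ≤ eLpNorm (fun x => f x y) ∞ μ := by
      rw [Measure.ae_ae_comm]
      · refine Eventually.of_forall fun y => ?_
        rw [eLpNorm_exponent_top]
        exact ae_le_eLpNormEssSup (f := fun x => f x y) (μ := μ)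
      · exact measurableSet_le hf (hm.comp measurable_snd)
    rw [eLpNorm_exponent_top]
    refine essSup_le_of_ae_le _ ?_
    filter_upwards [h1] with x hx
    exact lintegral_mono_ae hx
  · have e : ∀ g : α → ℝ≥0∞, eLpNorm g p μ = (∫⁻ x, g x ^ p.toReal ∂μ) ^ (1 / p.toReal) :=
      fun g => eLpNorm_eq_lintegral_rpow_enorm_toReal hp0 hpt
    simp_rw [e]
    have hr : 1 ≤ p.toReal := by
      rw [← ENNReal.toReal_one]; exact ENNReal.toReal_mono hpt hp
    -- The exponent 1 has no finite conjugate; there the inequality is Tonelli's theorem.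
    rcases hr.eq_or_lt with h1 | h1
    · rw [← h1]
      simp only [ENNReal.rpow_one, div_one]
      rw [lintegral_lintegral_swap hf.aemeasurable]
    · have hrs := Real.HolderConjugate.conjExponent h1
      have h2 := lintegral_rpow_lintegral_le (μ := μ) (ν := ν) hf hrs
      have h3 := ENNReal.rpow_le_rpow h2 (z := 1 / p.toReal) (by positivity)
      refine h3.trans (le_of_eq ?_)
      rw [← ENNReal.rpow_mul, mul_one_div_cancel (by positivity), ENNReal.rpow_one]

/-! ### Mixed norms and the weighted Young inequality -/

/-- The mixed norm of an `ℝ≥0∞`-valued function. -/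
def mixedENorm {d : ℕ} (p q : ℝ≥0∞) (P : E d × E d → ℝ≥0∞) : ℝ≥0∞ :=
  eLpNorm (fun ω => eLpNorm (fun x => P (x, ω)) p volume) q volume

theorem mixedNorm_eq_mixedENorm {d : ℕ} (p q : ℝ≥0∞) (m F : E d × E d → ℝ) :
    mixedNorm p q m F = mixedENorm p q (fun z => ‖F z‖ₑ * ‖m z‖ₑ) := by
  unfold mixedNorm mixedENorm
  congr 1
  ext ω
  rw [← eLpNorm_enorm]
  simp only [enorm_mul]

theorem mixedENorm_mono {d : ℕ} (p q : ℝ≥0∞) {P Q : E d × E d → ℝ≥0∞} (h : ∀ z, P z ≤ Q z) :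
    mixedENorm p q P ≤ mixedENorm p q Q :=
  eLpNorm_mono_enorm fun ω => eLpNorm_mono_enorm fun x => h (x, ω)

/-- A constant leaves a lower integral if it is finite or if the function is measurable. Both cases
occur below: finite constants with arbitrary functions, and kernel values that may be ∞ with
measurable functions. -/
theorem eLpNorm_const_mul_ennreal {α : Type*} [MeasurableSpace α] {μ : Measure α} (p c : ℝ≥0∞)
    (f : α → ℝ≥0∞) (h : c ≠ ∞ ∨ Measurable f) : eLpNorm (fun x => c * f x) p μ = c * eLpNorm f p μ := by
  by_cases hp0 : p = 0
  · simp [hp0]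
  by_cases hpt : p = ∞
  · rw [hpt, eLpNorm_exponent_top, eLpNorm_exponent_top]
    exact ENNReal.essSup_const_mul
  · have hr : 0 < p.toReal := ENNReal.toReal_pos hp0 hpt
    simp_rw [eLpNorm_eq_lintegral_rpow_enorm_toReal hp0 hpt, enorm_eq_self,
      ENNReal.mul_rpow_of_nonneg _ _ hr.le]
    have h1 : ∫⁻ x, c ^ p.toReal * f x ^ p.toReal ∂μ
        = c ^ p.toReal * ∫⁻ x, f x ^ p.toReal ∂μ := by
      rcases h with hc | hf
      · exact lintegral_const_mul' _ _ (ENNReal.rpow_ne_top_of_nonneg hr.le hc)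
      · exact lintegral_const_mul _ (hf.pow_const _)
    rw [h1, ENNReal.mul_rpow_of_nonneg _ _ (by positivity), ← ENNReal.rpow_mul,
      mul_one_div_cancel hr.ne', ENNReal.rpow_one]

theorem mixedENorm_const_mul {d : ℕ} (p q : ℝ≥0∞) {c : ℝ≥0∞} (hc : c ≠ ∞)
    (P : E d × E d → ℝ≥0∞) : mixedENorm p q (fun z => c * P z) = c * mixedENorm p q P := by
  unfold mixedENorm
  simp_rw [eLpNorm_const_mul_ennreal p c _ (Or.inl hc)]
  exact eLpNorm_const_mul_ennreal q c _ (Or.inl hc)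

/-- Minkowski is applied twice, first in x and then in ω; by translation invariance every shift of P
has the mixed norm of P. -/
theorem mixedENorm_lintegral_translate_le {d : ℕ} {p q : ℝ≥0∞} (hp : 1 ≤ p) (hq : 1 ≤ q)
    {κ P : E d × E d → ℝ≥0∞} (hκ : Measurable κ) (hP : Measurable P) :
    mixedENorm p q (fun z => ∫⁻ u, κ u * P (z + u)) ≤ (∫⁻ u, κ u) * mixedENorm p q P := by
  have hN : Measurable fun ω => eLpNorm (fun x => P (x, ω)) p volume :=
    measurable_eLpNorm_prod (f := fun x ω => P (x, ω)) hP hp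
  have hinner : ∀ (u : E d × E d) (ω : E d),
      eLpNorm (fun x => κ u * P ((x, ω) + u)) p volume
        = κ u * eLpNorm (fun x => P (x, ω + u.2)) p volume := by
    intro u ω
    have hm : Measurable fun x => P (x, ω + u.2) := hP.comp (by fun_prop)
    have hm' : Measurable fun x => P ((x, ω) + u) := hP.comp (by fun_prop)
    rw [eLpNorm_const_mul_ennreal p _ _ (Or.inr hm')]
    congr 1
    exact eLpNorm_comp_measurePreserving (g := fun x => P (x, ω + u.2))
      hm.aestronglyMeasurable (measurePreserving_add_right volume u.1)
  have houter : ∀ u : E d × E d,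
      eLpNorm (fun ω => κ u * eLpNorm (fun x => P (x, ω + u.2)) p volume) q volume
        = κ u * mixedENorm p q P := by
    intro u
    have hm : Measurable fun ω => eLpNorm (fun x => P (x, ω + u.2)) p volume :=
      hN.comp (measurable_add_const u.2)
    rw [eLpNorm_const_mul_ennreal q _ _ (Or.inr hm)]
    congr 1
    exact eLpNorm_comp_measurePreserving (g := fun ω => eLpNorm (fun x => P (x, ω)) p volume)
      hN.aestronglyMeasurable (measurePreserving_add_right volume u.2)
  calc mixedENorm p q (fun z => ∫⁻ u, κ u * P (z + u))
      ≤ eLpNorm (fun ω => ∫⁻ u, eLpNorm (fun x => κ u * P ((x, ω) + u)) p volume) q volume := by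
        refine eLpNorm_mono_enorm fun ω => ?_
        exact eLpNorm_lintegral_le (f := fun x u => κ u * P ((x, ω) + u))
          ((hκ.comp measurable_snd).mul (hP.comp (by fun_prop))) hp
    _ = eLpNorm (fun ω => ∫⁻ u : E d × E d,
          κ u * eLpNorm (fun x => P (x, ω + u.2)) p volume) q volume := by simp_rw [hinner]
    _ ≤ ∫⁻ u : E d × E d, eLpNorm (fun ω =>
          κ u * eLpNorm (fun x => P (x, ω + u.2)) p volume) q volume :=
        eLpNorm_lintegral_le (f := fun ω (u : E d × E d) =>
          κ u * eLpNorm (fun x => P (x, ω + u.2)) p volume)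
          ((hκ.comp measurable_snd).mul (hN.comp (by fun_prop))) hq
    _ = _ := by
      simp_rw [houter]
      exact lintegral_mul_const _ hκ

theorem IsSubmultWeight.neg {d : ℕ} {v : E d × E d → ℝ} (hv : IsSubmultWeight v)
    (z : E d × E d) : v (-z) = v z := by
  obtain ⟨x, ω⟩ := z
  rw [Prod.neg_mk, hv.neg_fst, hv.neg_snd]

theorem IsSubmultWeight.pos {d : ℕ} {v : E d × E d → ℝ} (hv : IsSubmultWeight v)
    (z : E d × E d) : 0 < v z :=
  one_pos.trans_le (hv.one_le z)

/-- A moderate weight is equivalent to a measurable one. -/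
theorem IsModerate.exists_measurable {d : ℕ} {v m : E d × E d → ℝ} (hv : IsSubmultWeight v)
    (hm : IsModerate v m) : ∃ (m' : E d × E d → ℝ≥0∞) (C : ℝ), 0 < C ∧ Measurable m' ∧
      (∀ z, m' z ≤ ENNReal.ofReal C * ‖m z‖ₑ) ∧
      ∀ z u, ‖m z‖ₑ ≤ ENNReal.ofReal (C * v u) * m' (z + u) := by
  obtain ⟨C, hC, hmod⟩ := hm.moderate
  have hen : ∀ z, ‖m z‖ₑ = ENNReal.ofReal (m z) := fun z => Real.enorm_of_nonneg (hm.nonneg z)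
  have hv0 := hv.pos 0
  -- The regularisation m'(z) = sup_w m(w) / v(w - z) is a supremum of continuous functions, so it
  -- is lower semicontinuous and hence Borel, whereas m is only a.e. measurable. Moderateness gives
  -- m' ≤ C m, and the index w = z gives m(z) ≤ v(0) m'(z), whence the factor v(0) in the constant.
  refine ⟨fun z => ⨆ w, ENNReal.ofReal (m w / v (w - z)), C * v 0, by positivity, ?_, ?_, ?_⟩
  · refine LowerSemicontinuous.measurable (lowerSemicontinuous_iSup fun w => ?_)
    have hc : Continuous fun z => m w / v (w - z) :=
      continuous_const.div (hv.continuous.comp (by fun_prop)) fun z => (hv.pos _).ne'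
    exact (ENNReal.continuous_ofReal.comp hc).lowerSemicontinuous
  · intro z
    rw [hen, ← ENNReal.ofReal_mul (by positivity)]
    refine iSup_le fun w => ENNReal.ofReal_le_ofReal ?_
    rw [div_le_iff₀ (hv.pos _)]
    have h1 := hmod (w - z) z
    rw [sub_add_cancel] at h1
    have h2 : 0 ≤ C * m z * v (w - z) := by
      have := hm.nonneg z; have := (hv.pos (w - z)).le; positivity
    nlinarith [hv.one_le 0]
  · intro z u
    have h1 : ENNReal.ofReal (m (z + u) / v (z + u - (z + u)))
        ≤ ⨆ w, ENNReal.ofReal (m w / v (w - (z + u))) :=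
      le_iSup (fun w => ENNReal.ofReal (m w / v (w - (z + u)))) (z + u)
    refine le_trans ?_ (mul_le_mul_right h1 _)
    have hvu := hv.pos u
    rw [hen, ← ENNReal.ofReal_mul (by positivity), sub_self]
    apply ENNReal.ofReal_le_ofReal
    have h2 := hmod (-u) (z + u)
    rw [hv.neg, neg_add_cancel_comm_assoc] at h2
    refine h2.trans (le_of_eq ?_)
    field_simp

/-- Weighted Young inequality for mixed norms. -/
theorem mixedENorm_young {d : ℕ} {v m : E d × E d → ℝ} (hv : IsSubmultWeight v)
    (hm : IsModerate v m) : ∃ C : ℝ, 0 < C ∧ ∀ p q : ℝ≥0∞, 1 ≤ p → 1 ≤ q →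
      ∀ K G : E d × E d → ℝ≥0∞, Measurable K → Measurable G →
      mixedENorm p q (fun z => (∫⁻ w, K (w - z) * G w) * ‖m z‖ₑ) ≤
        ENNReal.ofReal C * (∫⁻ u, K u * ENNReal.ofReal (v u)) *
          mixedENorm p q (fun z => G z * ‖m z‖ₑ) := by
  obtain ⟨m', C, hC, hm', h1, h2⟩ := hm.exists_measurable hv
  refine ⟨C * C, by positivity, fun p q hp hq K G hK hG => ?_⟩
  have hvm : Measurable fun u => ENNReal.ofReal (v u) := hv.continuous.measurable.ennreal_ofReal
  set κ : E d × E d → ℝ≥0∞ := fun u => K u * ENNReal.ofReal (v u)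
  have hκ : Measurable κ := hK.mul hvm
  calc _ ≤ mixedENorm p q (fun z => ENNReal.ofReal C * ∫⁻ u, κ u * (G (z + u) * m' (z + u))) := by
        refine mixedENorm_mono p q fun z => ?_
        -- After w = z + u, the bound m(z) ≤ C v(u) m'(z + u) moves v onto the kernel and m' onto G.
        -- The second factor C arises on returning from m' to m.
        rw [← lintegral_add_left_eq_self _ z, ← lintegral_const_mul' _ _ ENNReal.ofReal_ne_top,
          ← lintegral_mul_const' _ _ enorm_ne_top]
        refine lintegral_mono fun u => ?_
        simp only [add_sub_cancel_left]
        calc _ ≤ K u * G (z + u) * (ENNReal.ofReal (C * v u) * m' (z + u)) :=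
              mul_le_mul_right (h2 z u) _
          _ = _ := by rw [ENNReal.ofReal_mul hC.le]; simp only [κ]; ring
    _ = ENNReal.ofReal C * mixedENorm p q (fun z => ∫⁻ u, κ u * (G (z + u) * m' (z + u))) :=
        mixedENorm_const_mul p q ENNReal.ofReal_ne_top _
    _ ≤ ENNReal.ofReal C * ((∫⁻ u, κ u) * mixedENorm p q (fun z => G z * m' z)) :=
        mul_le_mul_right (mixedENorm_lintegral_translate_le hp hq hκ (hG.mul hm')) _
    _ ≤ ENNReal.ofReal C * ((∫⁻ u, κ u) *
          mixedENorm p q (fun z => ENNReal.ofReal C * (G z * ‖m z‖ₑ))) := by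
        gcongr
        refine mixedENorm_mono p q fun z => ?_
        calc _ ≤ G z * (ENNReal.ofReal C * ‖m z‖ₑ) := mul_le_mul_right (h1 z) _
          _ = _ := by ring
    _ = _ := by
      rw [mixedENorm_const_mul p q ENNReal.ofReal_ne_top, ENNReal.ofReal_mul hC.le]; ring

/-- Only pointwise domination is asked of F, not measurability. The factor c is there for the ‖φ₁‖²
of the change of window. -/
theorem mixedNorm_young {d : ℕ} {v m : E d × E d → ℝ} (hv : IsSubmultWeight v)
    (hm : IsModerate v m) : ∃ C : ℝ, 0 < C ∧ ∀ p q : ℝ≥0∞, 1 ≤ p → 1 ≤ q →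
      ∀ (c : ℝ≥0∞) (K : E d × E d → ℝ≥0∞) (F G : E d × E d → ℝ), c ≠ ∞ → Measurable K →
      Measurable G → (∀ z, c * ‖F z‖ₑ ≤ ∫⁻ w, K (w - z) * ‖G w‖ₑ) →
      c * mixedNorm p q m F ≤
        ENNReal.ofReal C * (∫⁻ u, K u * ENNReal.ofReal (v u)) * mixedNorm p q m G := by
  obtain ⟨C, hC, hY⟩ := mixedENorm_young hv hm
  refine ⟨C, hC, fun p q hp hq c K F G hc hK hG h => ?_⟩
  rw [mixedNorm_eq_mixedENorm, mixedNorm_eq_mixedENorm, ← mixedENorm_const_mul p q hc]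
  refine le_trans (mixedENorm_mono p q fun z => ?_) (hY p q hp hq K _ hK hG.enorm)
  rw [← mul_assoc]
  exact mul_le_mul_left (h z) _

theorem mixedNorm_le_const_mul {d : ℕ} (p q : ℝ≥0∞) (m : E d × E d → ℝ) {c : ℝ≥0∞} (hc : c ≠ ∞)
    {F G : E d × E d → ℝ} (h : ∀ z, ‖F z‖ₑ ≤ c * ‖G z‖ₑ) :
    mixedNorm p q m F ≤ c * mixedNorm p q m G := by
  rw [mixedNorm_eq_mixedENorm, mixedNorm_eq_mixedENorm, ← mixedENorm_const_mul p q hc]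
  refine mixedENorm_mono p q fun z => ?_
  rw [← mul_assoc]
  exact mul_le_mul_left (h z) _

/-! ### Time-frequency shifts as unitary operators -/

theorem coeFn_tfShift {d : ℕ} (z : E d × E d) (ψ : L2 d) : tfShift z ψ =ᵐ[volume]
    fun t => Complex.exp (2 * Real.pi * Complex.I * (inner ℝ z.2 t : ℝ)) * ψ (t - z.1) :=
  (memLp_tfShift z ψ).coeFn_toLp

theorem ae_comp_sub {d : ℕ} {p : E d → Prop} (h : ∀ᵐ t, p t) (x : E d) :
    ∀ᵐ t, p (t - x) :=
  (measurePreserving_sub_right volume x).quasiMeasurePreserving.ae h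

theorem tfShift_add {d : ℕ} (z : E d × E d) (f g : L2 d) :
    tfShift z (f + g) = tfShift z f + tfShift z g := by
  refine Lp.ext ?_
  filter_upwards [coeFn_tfShift z (f + g), coeFn_tfShift z f, coeFn_tfShift z g,
    Lp.coeFn_add (tfShift z f) (tfShift z g), ae_comp_sub (Lp.coeFn_add f g) z.1]
    with t h1 h2 h3 h4 h5
  rw [h1, h4, Pi.add_apply, h2, h3, h5, Pi.add_apply, mul_add]

theorem tfShift_smul {d : ℕ} (z : E d × E d) (c : ℂ) (f : L2 d) :
    tfShift z (c • f) = c • tfShift z f := by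
  refine Lp.ext ?_
  filter_upwards [coeFn_tfShift z (c • f), coeFn_tfShift z f,
    Lp.coeFn_smul c (tfShift z f), ae_comp_sub (Lp.coeFn_smul c f) z.1]
    with t h1 h2 h4 h5
  rw [h1, h4, Pi.smul_apply, h2, h5, Pi.smul_apply, smul_eq_mul, smul_eq_mul]
  ring

theorem tfShift_zero {d : ℕ} (f : L2 d) : tfShift 0 f = f := by
  refine Lp.ext ?_
  filter_upwards [coeFn_tfShift 0 f] with t h1
  rw [h1]; simp

/-- Translating a modulation by z.1 produces the phase, so π is a representation only up to
unimodular factors. -/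
theorem tfShift_tfShift {d : ℕ} (z w : E d × E d) (f : L2 d) :
    tfShift z (tfShift w f) =
      Complex.exp (-2 * Real.pi * Complex.I * (inner ℝ w.2 z.1 : ℝ)) • tfShift (z + w) f := by
  refine Lp.ext ?_
  filter_upwards [coeFn_tfShift z (tfShift w f), ae_comp_sub (coeFn_tfShift w f) z.1,
    Lp.coeFn_smul (Complex.exp (-2 * Real.pi * Complex.I * (inner ℝ w.2 z.1 : ℝ)))
      (tfShift (z + w) f), coeFn_tfShift (z + w) f] with t h1 h2 h3 h4
  rw [h1, h2, h3, Pi.smul_apply, h4, smul_eq_mul, ← mul_assoc, ← mul_assoc, ← Complex.exp_add,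
    ← Complex.exp_add, Prod.fst_add, Prod.snd_add, sub_sub]
  congr 2
  rw [inner_sub_right, inner_add_left]
  push_cast; ring

theorem norm_tfShift {d : ℕ} (z : E d × E d) (f : L2 d) : ‖tfShift z f‖ = ‖f‖ := by
  rw [tfShift, Lp.norm_toLp, Lp.norm_def]
  congr 1
  rw [← eLpNorm_comp_measurePreserving (Lp.memLp f).1 (measurePreserving_sub_right volume z.1)]
  refine eLpNorm_congr_norm_ae (Eventually.of_forall fun t => ?_)
  rw [norm_mul, Complex.norm_exp]; simp

/-- The time-frequency shift `π(z)` as a unitary operator. -/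
def tfShiftEquiv {d : ℕ} (z : E d × E d) : L2 d ≃ₗᵢ[ℂ] L2 d where
  toFun := tfShift z
  -- For z = (x, ω), π(z)π(-z) is e^{2πi ω·x} times the identity; this phase cancels it.
  invFun f := Complex.exp (-2 * Real.pi * Complex.I * (inner ℝ z.2 z.1 : ℝ)) • tfShift (-z) f
  map_add' := tfShift_add z
  map_smul' := tfShift_smul z
  left_inv f := by
    simp only []
    rw [tfShift_tfShift, neg_add_cancel, tfShift_zero, smul_smul, ← Complex.exp_add, Prod.fst_neg,
      inner_neg_right]
    convert one_smul ℂ f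
    rw [Complex.exp_eq_one_iff]
    exact ⟨0, by push_cast; ring⟩
  right_inv f := by
    simp only []
    rw [tfShift_smul, tfShift_tfShift, add_neg_cancel, tfShift_zero, smul_smul, ← Complex.exp_add,
      Prod.snd_neg, inner_neg_left]
    convert one_smul ℂ f
    rw [Complex.exp_eq_one_iff]
    exact ⟨0, by push_cast; ring⟩
  norm_map' := norm_tfShift z

@[simp]
theorem tfShiftEquiv_apply {d : ℕ} (z : E d × E d) (f : L2 d) : tfShiftEquiv z f = tfShift z f :=
  rfl

theorem inner_tfShift_tfShift {d : ℕ} (z : E d × E d) (f g : L2 d) :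
    inner ℂ (tfShift z f) (tfShift z g) = inner ℂ f g :=
  (tfShiftEquiv z).inner_map_map f g

theorem norm_stft_tfShift {d : ℕ} (φ ψ : L2 d) (z w : E d × E d) :
    ‖stft φ (tfShift z ψ) w‖ = ‖stft φ ψ (w - z)‖ := by
  rw [stft_tfShift, norm_mul, Complex.norm_exp]; simp

/-- By unitarity ⟨ψ, π(z)φ⟩ equals ⟨π(-z)ψ, φ⟩ up to a phase. This lets window and function trade
places, which is harmless under the even weight v. -/
theorem norm_stft_swap {d : ℕ} (φ ψ : L2 d) (z : E d × E d) :
    ‖stft φ ψ z‖ = ‖stft ψ φ (-z)‖ := by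
  rw [stft, stft, ← inner_tfShift_tfShift z (tfShift (-z) ψ) φ, tfShift_tfShift, add_neg_cancel,
    tfShift_zero, inner_smul_left, norm_mul, RCLike.norm_conj, Complex.norm_exp, norm_inner_symm]
  simp

theorem stronglyMeasurable_stft {d : ℕ} (φ ψ : L2 d) : StronglyMeasurable (stft φ ψ) := by
  have h0 : stft φ ψ = fun z => ∫ t, ψ t * conj (φ (t - z.1)) *
      Complex.exp (-2 * Real.pi * Complex.I * (inner ℝ z.2 t : ℝ)) :=
    funext fun z => stft_eq_integral φ ψ z
  rw [h0]
  have h1 : StronglyMeasurable (fun w : (E d × E d) × E d => ψ w.2) :=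
    (Lp.stronglyMeasurable ψ).comp_measurable (by fun_prop)
  have h2 : StronglyMeasurable (fun w : (E d × E d) × E d => conj (φ (w.2 - w.1.1))) :=
    Complex.continuous_conj.comp_stronglyMeasurable
      ((Lp.stronglyMeasurable φ).comp_measurable (by fun_prop))
  have h3 : StronglyMeasurable (fun w : (E d × E d) × E d =>
      Complex.exp (-2 * Real.pi * Complex.I * (inner ℝ w.1.2 w.2 : ℝ))) := by
    apply Continuous.stronglyMeasurable
    fun_prop
  exact StronglyMeasurable.integral_prod_right ((h1.mul h2).mul h3)

/-! ### Moyal's identity -/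

theorem enorm_sq_eq_lintegral {α : Type*} [MeasurableSpace α] {μ : Measure α} (f : Lp ℂ 2 μ) :
    ‖f‖ₑ ^ 2 = ∫⁻ t, ‖f t‖ₑ ^ 2 ∂μ := by
  have := eLpNorm_nnreal_pow_eq_lintegral (p := 2) (f := f) (μ := μ) (by norm_num)
  rw [Lp.enorm_def]
  simpa using this

theorem lintegral_fourier_sq {d : ℕ} (g : E d → ℂ) (hg : Integrable g) (hg2 : MemLp g 2) :
    ∫⁻ w, ‖𝓕 g w‖ₑ ^ 2 = ∫⁻ t, ‖g t‖ₑ ^ 2 := by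
  calc _ = ∫⁻ w, ‖(𝓕 (hg2.toLp g) : L2 d) w‖ₑ ^ 2 := by
        refine lintegral_congr_ae ?_
        filter_upwards [aeeq_fourier g hg hg2] with w hw
        rw [hw]
    _ = ‖hg2.toLp g‖ₑ ^ 2 := by
        rw [← enorm_sq_eq_lintegral, ← ofReal_norm, ← ofReal_norm, Lp.norm_fourier_eq]
    _ = _ := by
        rw [enorm_sq_eq_lintegral]
        refine lintegral_congr_ae ?_
        filter_upwards [hg2.coeFn_toLp] with w hw
        rw [hw]

/-- For fixed x, V_φ f(x, ·) is the Fourier transform of t ↦ f(t) conj φ(t - x). Plancherel in ω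
followed by Tonelli in x gives the identity. -/
theorem lintegral_stft_sq {d : ℕ} (φ f : L2 d) :
    ∫⁻ z, ‖stft φ f z‖ₑ ^ 2 = (‖φ‖ₑ * ‖f‖ₑ) ^ 2 := by
  have hfm : Measurable fun t => ‖f t‖ₑ ^ 2 := (Lp.stronglyMeasurable f).measurable.enorm.pow_const 2
  have hφm : Measurable fun t => ‖φ t‖ₑ ^ 2 := (Lp.stronglyMeasurable φ).measurable.enorm.pow_const 2
  have hφx : ∀ x : E d, MemLp (fun t => conj (φ (t - x))) 2 := fun x =>
    ((Lp.memLp φ).comp_measurePreserving (measurePreserving_sub_right volume x)).star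
  have hint : ∀ x : E d, Integrable fun t => f t * conj (φ (t - x)) := fun x =>
    (Lp.memLp f).integrable_mul (hφx x)
  have hF : ∀ x ω : E d, stft φ f (x, ω) = 𝓕 (fun t => f t * conj (φ (t - x))) ω := by
    intro x ω
    rw [stft_eq_integral, Real.fourier_eq']
    refine integral_congr_ae (Eventually.of_forall fun t => ?_)
    simp only [smul_eq_mul]
    rw [mul_comm, real_inner_comm]
    congr 2
    push_cast; ring
  have hm : Measurable (Function.uncurry fun (x t : E d) => ‖f t‖ₑ ^ 2 * ‖φ (t - x)‖ₑ ^ 2) :=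
    (hfm.comp measurable_snd).mul (hφm.comp (by fun_prop))
  have htot : ∫⁻ x, ∫⁻ t, ‖f t‖ₑ ^ 2 * ‖φ (t - x)‖ₑ ^ 2 = (‖φ‖ₑ * ‖f‖ₑ) ^ 2 := by
    rw [lintegral_lintegral_swap hm.aemeasurable]
    have h2 : ∀ t : E d, ∫⁻ x, ‖f t‖ₑ ^ 2 * ‖φ (t - x)‖ₑ ^ 2
        = ‖f t‖ₑ ^ 2 * ∫⁻ x, ‖φ x‖ₑ ^ 2 := by
      intro t
      have hm' : Measurable fun x => ‖φ (t - x)‖ₑ ^ 2 := hφm.comp (measurable_const_sub t)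
      rw [lintegral_const_mul _ hm', lintegral_sub_left_eq_self (fun x => ‖φ x‖ₑ ^ 2) t]
    simp_rw [h2]
    rw [lintegral_mul_const _ hfm, ← enorm_sq_eq_lintegral, ← enorm_sq_eq_lintegral, mul_pow,
      mul_comm]
  -- The product f · conj φ(· - x) is integrable for every x, but its square integrability is known
  -- only for a.e. x, from the finite total.
  have hfin : ∀ᵐ x : E d, ∫⁻ t, ‖f t‖ₑ ^ 2 * ‖φ (t - x)‖ₑ ^ 2 < ∞ := by
    refine ae_lt_top hm.lintegral_prod_right' ?_
    rw [htot]
    exact ENNReal.pow_ne_top (ENNReal.mul_ne_top enorm_ne_top enorm_ne_top)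
  rw [Measure.volume_eq_prod,
    lintegral_prod _ ((stronglyMeasurable_stft φ f).measurable.enorm.pow_const 2).aemeasurable,
    ← htot]
  refine lintegral_congr_ae ?_
  filter_upwards [hfin] with x hx
  simp_rw [hF]
  have h0 : ∀ t, ‖f t * conj (φ (t - x))‖ₑ ^ 2 = ‖f t‖ₑ ^ 2 * ‖φ (t - x)‖ₑ ^ 2 := fun t => by
    simp [enorm_mul, mul_pow]
  have h2 : MemLp (fun t => f t * conj (φ (t - x))) 2 := by
    refine ⟨(hint x).1, ?_⟩
    have h3 := eLpNorm_nnreal_pow_eq_lintegral (p := 2) (μ := volume)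
      (f := fun t => f t * conj (φ (t - x))) (by norm_num)
    have h4 : eLpNorm (fun t => f t * conj (φ (t - x))) 2 volume ^ 2
        = ∫⁻ t, ‖f t * conj (φ (t - x))‖ₑ ^ 2 := by simpa using h3
    simp_rw [h0] at h4
    by_contra hh
    rw [not_lt_top_iff.1 hh] at h4
    rw [← h4] at hx
    simp at hx
  rw [lintegral_fourier_sq _ (hint x) h2]
  simp_rw [h0]

theorem memLp_stft {d : ℕ} (φ f : L2 d) : MemLp (stft φ f) 2 := by
  refine ⟨(stronglyMeasurable_stft φ f).aestronglyMeasurable, ?_⟩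
  have h3 := eLpNorm_nnreal_pow_eq_lintegral (p := 2) (μ := volume)
      (f := stft φ f) (by norm_num)
  have h4 : eLpNorm (stft φ f) 2 volume ^ 2 = ∫⁻ t, ‖stft φ f t‖ₑ ^ 2 := by simpa using h3
  rw [lintegral_stft_sq] at h4
  by_contra hh
  rw [not_lt_top_iff.1 hh] at h4
  exact ENNReal.pow_ne_top (ENNReal.mul_ne_top enorm_ne_top enorm_ne_top) (n := 2)
    (h4.symm.trans (by simp))

/-- The short-time Fourier transform as a linear map into `L²(ℝ²ᵈ)`. -/
def stftL2 {d : ℕ} (φ : L2 d) : L2 d →ₗ[ℂ] Lp ℂ 2 (volume : Measure (E d × E d)) where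
  toFun f := (memLp_stft φ f).toLp _
  map_add' f g := by
    rw [← MemLp.toLp_add]
    exact MemLp.toLp_congr _ _ (Eventually.of_forall fun z => stft_add φ f g z)
  map_smul' c f := by
    rw [RingHom.id_apply, ← MemLp.toLp_const_smul]
    exact MemLp.toLp_congr _ _ (Eventually.of_forall fun z => stft_smul c φ f z)

theorem norm_stftL2 {d : ℕ} (φ f : L2 d) : ‖stftL2 φ f‖ = ‖φ‖ * ‖f‖ := by
  have h : ‖stftL2 φ f‖ₑ ^ 2 = (‖φ‖ₑ * ‖f‖ₑ) ^ 2 := by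
    rw [enorm_sq_eq_lintegral, ← lintegral_stft_sq]
    refine lintegral_congr_ae ?_
    filter_upwards [(memLp_stft φ f).coeFn_toLp] with w hw
    rw [stftL2, LinearMap.coe_mk, AddHom.coe_mk, hw]
  have h2 : ‖stftL2 φ f‖ₑ = ‖φ‖ₑ * ‖f‖ₑ :=
    le_antisymm ((ENNReal.pow_le_pow_left_iff two_ne_zero).1 h.le)
      ((ENNReal.pow_le_pow_left_iff two_ne_zero).1 h.ge)
  have := congrArg ENNReal.toReal h2
  simpa [ENNReal.toReal_mul] using this

/-- Moyal's identity. -/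
theorem integral_stft_mul_stft {d : ℕ} (φ f g : L2 d) :
    ∫ z, conj (stft φ f z) * stft φ g z = (‖φ‖ : ℂ) ^ 2 * inner ℂ f g := by
  have h1 : inner ℂ (stftL2 φ f) (stftL2 φ g) = ∫ z, conj (stft φ f z) * stft φ g z := by
    rw [L2.inner_def]
    refine integral_congr_ae ?_
    filter_upwards [(memLp_stft φ f).coeFn_toLp, (memLp_stft φ g).coeFn_toLp] with w hf hg
    simp only [stftL2, LinearMap.coe_mk, AddHom.coe_mk]
    rw [hf, hg, RCLike.inner_apply, mul_comm]
  -- Polarisation: the linear map f ↦ V_φ f multiplies norms by ‖φ‖, hence inner products by ‖φ‖².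
  rw [← h1, inner_eq_sum_norm_sq_div_four, inner_eq_sum_norm_sq_div_four f g]
  simp only [← map_add, ← map_sub, ← map_smul, norm_stftL2]
  have e : ∀ r : ℝ, (RCLike.ofReal r : ℂ) = Complex.ofReal r := fun _ => rfl
  simp only [e]
  push_cast
  ring

/-- Open sets are countable unions of balls here. With this criterion, maps into L² and L¹ need only
measurable distance functions, and continuity of z ↦ π(z)ξ is never used. -/
theorem stronglyMeasurable_of_measurable_dist {α X : Type*} [MeasurableSpace α]
    [PseudoMetricSpace X] [SecondCountableTopology X] {f : α → X}
    (h : ∀ x, Measurable fun a => dist (f a) x) : StronglyMeasurable f := by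
  let _ : MeasurableSpace X := borel X
  have : BorelSpace X := ⟨rfl⟩
  refine Measurable.stronglyMeasurable (measurable_of_isOpen fun U hU => ?_)
  have h1 : ∀ y : U, ∃ r > 0, Metric.ball (y : X) r ⊆ U := fun y =>
    Metric.isOpen_iff.1 hU y y.2
  choose r hr hrU using h1
  obtain ⟨T, hT, hTU⟩ := TopologicalSpace.isOpen_iUnion_countable
    (fun y : U => Metric.ball (y : X) (r y)) fun y => Metric.isOpen_ball
  have h2 : U = ⋃ y ∈ T, Metric.ball (y : X) (r y) := by
    rw [hTU]
    refine Set.Subset.antisymm (fun y hy => ?_) (Set.iUnion_subset hrU)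
    exact Set.mem_iUnion.2 ⟨⟨y, hy⟩, Metric.mem_ball_self (hr _)⟩
  rw [h2, Set.preimage_iUnion₂]
  refine MeasurableSet.biUnion hT fun y _ => ?_
  exact measurableSet_lt (h y) measurable_const

/-- Since π(z) is isometric, ‖π(z)ξ - g‖² = ‖ξ‖² - 2 Re V_ξ g(z) + ‖g‖², which is measurable in z.
-/
theorem stronglyMeasurable_tfShift {d : ℕ} (ξ : L2 d) :
    StronglyMeasurable fun z : E d × E d => tfShift z ξ := by
  have : Fact ((2 : ℝ≥0∞) ≠ ∞) := ⟨by norm_num⟩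
  refine stronglyMeasurable_of_measurable_dist fun g => ?_
  have h : ∀ z : E d × E d, dist (tfShift z ξ) g
      = Real.sqrt (‖ξ‖ ^ 2 - 2 * (stft ξ g z).re + ‖g‖ ^ 2) := by
    intro z
    rw [dist_eq_norm, ← Real.sqrt_sq (norm_nonneg _), norm_sub_sq (𝕜 := ℂ), norm_tfShift]
    rfl
  simp_rw [h]
  have := (stronglyMeasurable_stft ξ g).measurable
  fun_prop

/-! ### The space `M¹_v` inside L¹ and its bounded functionals -/

theorem IsSubmultWeight.measurable_ofReal {d : ℕ} {v : E d × E d → ℝ} (hv : IsSubmultWeight v) :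
    Measurable fun z => (v z : ℂ) :=
  (Complex.continuous_ofReal.comp hv.continuous).measurable

theorem integrable_stft_mul_weight {d : ℕ} {v : E d × E d → ℝ} (φ : M1 v) :
    Integrable fun z => stft (gaussian d) φ z * (v z : ℂ) :=
  φ.2

theorem integrable_stft_tfShift_mul_weight {d : ℕ} {v : E d × E d → ℝ} (hv : IsSubmultWeight v)
    (z : E d × E d) (φ : M1 v) :
    Integrable fun w => stft (gaussian d) (tfShift z φ) w * (v w : ℂ) :=
  tfShift_mem_M1 hv z φ.2

/-- The isometric embedding `φ ↦ V_{φ₀}φ · v` of `M¹_v` into `L¹(ℝ²ᵈ)`. -/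
def M1embed {d : ℕ} (v : E d × E d → ℝ) : M1 v →ₗ[ℂ] Lp ℂ 1 (volume : Measure (E d × E d)) where
  toFun φ := (memLp_one_iff_integrable.2 (integrable_stft_mul_weight φ)).toLp _
  map_add' f g := by
    rw [← MemLp.toLp_add]
    refine MemLp.toLp_congr _ _ (Eventually.of_forall fun z => ?_)
    simp only [Submodule.coe_add, stft_add, Pi.add_apply, add_mul]
  map_smul' c f := by
    rw [RingHom.id_apply, ← MemLp.toLp_const_smul]
    refine MemLp.toLp_congr _ _ (Eventually.of_forall fun z => ?_)
    simp only [Submodule.coe_smul, stft_smul, Pi.smul_apply, smul_eq_mul, mul_assoc]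

theorem coeFn_M1embed {d : ℕ} {v : E d × E d → ℝ} (φ : M1 v) :
    M1embed v φ =ᵐ[volume] fun z => stft (gaussian d) φ z * (v z : ℂ) :=
  (memLp_one_iff_integrable.2 (integrable_stft_mul_weight φ)).coeFn_toLp

theorem norm_M1embed {d : ℕ} {v : E d × E d → ℝ} (hv : IsSubmultWeight v) (φ : M1 v) :
    ‖M1embed v φ‖ = M1norm v φ := by
  rw [L1.norm_eq_integral_norm, M1norm]
  refine integral_congr_ae ?_
  filter_upwards [coeFn_M1embed φ] with z hz
  rw [hz, norm_mul, Complex.norm_real, Real.norm_of_nonneg (hv.nonneg z)]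

/-- The bound forces f to vanish on the kernel of J, so f descends to a bounded functional on the
range of J, to which Hahn–Banach applies. The space V needs no topology. -/
theorem exists_continuous_extension {V W : Type*} [AddCommGroup V] [Module ℂ V]
    [NormedAddCommGroup W] [NormedSpace ℂ W] (J : V →ₗ[ℂ] W) (f : V →ₗ[ℂ] ℂ) (C : ℝ)
    (h : ∀ x, ‖f x‖ ≤ C * ‖J x‖) : ∃ Λ : W →L[ℂ] ℂ, ∀ x, Λ (J x) = f x := by
  -- An algebraic section of J serves to write the descended functional as f ∘ g; another section
  -- would change g only by elements of ker J.
  obtain ⟨g, hg⟩ := J.rangeRestrict.exists_rightInverse_of_surjective J.range_rangeRestrict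
  have hg' : ∀ y, J (g y) = y := fun y => congrArg Subtype.val (LinearMap.congr_fun hg y)
  have hf₀ : ∀ y, ‖(f ∘ₗ g) y‖ ≤ C * ‖y‖ := fun y => by
    refine (h _).trans (le_of_eq ?_)
    rw [hg']
    rfl
  obtain ⟨Λ, hΛ, -⟩ := exists_extension_norm_eq _ ((f ∘ₗ g).mkContinuous C hf₀)
  refine ⟨Λ, fun x => ?_⟩
  have h1 : Λ (J x) = f (g (J.rangeRestrict x)) := hΛ (J.rangeRestrict x)
  have h2 : J (x - g (J.rangeRestrict x)) = 0 := by
    rw [map_sub, hg', sub_eq_zero]; rfl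
  have h3 : f (x - g (J.rangeRestrict x)) = 0 := by
    rw [← norm_le_zero_iff]
    refine (h _).trans (le_of_eq ?_)
    rw [h2, norm_zero, mul_zero]
  rw [map_sub, sub_eq_zero] at h3
  rw [h1, h3]

/-- Bounded antilinear functionals on `M¹_v` extend to `L¹(ℝ²ᵈ)`. -/
theorem exists_dual_extension {d : ℕ} {v : E d × E d → ℝ} (hv : IsSubmultWeight v)
    (ψ : M1dual v) : ∃ Λ : Lp ℂ 1 (volume : Measure (E d × E d)) →L[ℂ] ℂ,
      ∀ φ : M1 v, ψ.1 φ = conj (Λ (M1embed v φ)) := by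
  obtain ⟨C, hC⟩ := ψ.2
  let f : M1 v →ₗ[ℂ] ℂ :=
    { toFun := fun φ => conj (ψ.1 φ)
      map_add' := fun x y => by rw [map_add, map_add]
      map_smul' := fun c y => by
        rw [LinearMap.map_smulₛₗ, smul_eq_mul, map_mul, Complex.conj_conj]; rfl }
  obtain ⟨Λ, hΛ⟩ := exists_continuous_extension (M1embed v) f C fun φ => by
    rw [norm_M1embed hv]
    exact (RCLike.norm_conj _).trans_le (hC φ)
  refine ⟨Λ, fun φ => ?_⟩
  rw [hΛ]
  exact (Complex.conj_conj _).symm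

theorem stronglyMeasurable_stft_tfShift {d : ℕ} (φ ψ : L2 d) :
    StronglyMeasurable fun w : (E d × E d) × (E d × E d) => stft φ (tfShift w.1 ψ) w.2 := by
  simp_rw [stft_tfShift]
  refine StronglyMeasurable.mul ?_ ((stronglyMeasurable_stft φ ψ).comp_measurable (by fun_prop))
  exact (by fun_prop : Continuous _).stronglyMeasurable

/-- The L¹ distance to a fixed g is a parameter integral of a jointly measurable function of (z, x).
-/
theorem stronglyMeasurable_M1embed_shift {d : ℕ} {v : E d × E d → ℝ} (hv : IsSubmultWeight v)
    (φ : M1 v) : StronglyMeasurable fun z => M1embed v (M1shift hv z φ) := by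
  have : Fact ((1 : ℝ≥0∞) ≠ ∞) := ⟨by norm_num⟩
  have : SFinite (volume : Measure (E d × E d)) := inferInstance
  have : MeasurableSpace.CountablyGenerated (E d × E d) := inferInstance
  refine stronglyMeasurable_of_measurable_dist fun g => ?_
  have h : ∀ z : E d × E d, dist (M1embed v (M1shift hv z φ)) g
      = ∫ x, ‖stft (gaussian d) (tfShift z φ) x * (v x : ℂ) - g x‖ := by
    intro z
    rw [dist_eq_norm, L1.norm_eq_integral_norm]
    refine integral_congr_ae ?_
    filter_upwards [coeFn_M1embed (M1shift hv z φ), Lp.coeFn_sub (M1embed v (M1shift hv z φ)) g]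
      with x h1 h2
    rw [h2, Pi.sub_apply, h1]
    rfl
  simp_rw [h]
  have h1 : StronglyMeasurable fun w : (E d × E d) × (E d × E d) =>
      ‖stft (gaussian d) (tfShift w.1 φ) w.2 * (v w.2 : ℂ) - g w.2‖ :=
    (((stronglyMeasurable_stft_tfShift (gaussian d) φ).mul
      (hv.measurable_ofReal.comp measurable_snd).stronglyMeasurable).sub
      ((Lp.stronglyMeasurable g).comp_measurable measurable_snd)).norm
  exact h1.integral_prod_right.measurable

theorem stronglyMeasurable_dualStft {d : ℕ} {v : E d × E d → ℝ} (hv : IsSubmultWeight v)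
    (φ : M1 v) (ψ : M1dual v) : StronglyMeasurable (dualStft hv φ ψ) := by
  obtain ⟨Λ, hΛ⟩ := exists_dual_extension hv ψ
  have h : dualStft hv φ ψ = fun z => conj (Λ (M1embed v (M1shift hv z φ))) :=
    funext fun z => hΛ _
  rw [h]
  exact Complex.continuous_conj.comp_stronglyMeasurable
    (Λ.continuous.comp_stronglyMeasurable (stronglyMeasurable_M1embed_shift hv φ))

theorem IsSubmultWeight.le_mul_sub {d : ℕ} {v : E d × E d → ℝ} (hv : IsSubmultWeight v)
    (w z : E d × E d) : v w ≤ v z * v (w - z) := by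
  have h := hv.submult z (w - z)
  rwa [add_sub_cancel] at h

/-- Up to a phase, π(z) translates the short-time Fourier transform by z, and v(w) ≤ v(z) v(w - z).
-/
theorem M1norm_tfShift_le {d : ℕ} {v : E d × E d → ℝ} (hv : IsSubmultWeight v) {φ : L2 d}
    (hφ : φ ∈ M1 v) (z : E d × E d) : M1norm v (tfShift z φ) ≤ v z * M1norm v φ := by
  unfold M1norm
  rw [← integral_const_mul,
    ← integral_sub_right_eq_self (fun w => v z * (‖stft (gaussian d) φ w‖ * v w)) z]
  refine integral_mono (integrable_M1 hv (tfShift_mem_M1 hv z hφ))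
    (((integrable_M1 hv hφ).const_mul _).comp_sub_right z) fun w => ?_
  simp only [norm_stft_tfShift]
  nlinarith [mul_le_mul_of_nonneg_left (hv.le_mul_sub w z)
    (norm_nonneg (stft (gaussian d) φ (w - z)))]

/-! ### The reproducing formula and the change of window -/

/-- Set integrals are continuous on L¹, so they commute with Bochner integrals, and together they
determine an element of L¹. -/
theorem exists_setIntegralCLM {α : Type*} [MeasurableSpace α] (μ : Measure α) (s : Set α) :
    ∃ L : Lp ℂ 1 μ →L[ℂ] ℂ, ∀ f, L f = ∫ x in s, f x ∂μ := by
  refine ⟨(L1.integralCLM' ℂ).comp (LpToLpRestrictCLM α ℂ ℂ μ 1 s), fun f => ?_⟩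
  rw [ContinuousLinearMap.comp_apply, ← L1.integral_eq', L1.integral_eq_integral]
  exact integral_congr_ae (LpToLpRestrictCLM_coeFn ℂ s f)

/-- This is Moyal's identity for π(x)χ and φ: the second factor is the conjugate of
V_{φ₁}(π(x)χ)(w). -/
theorem integral_stft_mul_stft_tfShift {d : ℕ} (φ₁ φ χ : L2 d) (x : E d × E d) :
    ∫ w, stft φ₁ φ w * stft χ (tfShift w φ₁) x = (‖φ₁‖ : ℂ) ^ 2 * stft χ φ x := by
  rw [stft, ← integral_stft_mul_stft]
  refine integral_congr_ae (Eventually.of_forall fun w => ?_)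
  simp only [stft]
  rw [inner_conj_symm, mul_comm]

/-- The norm of the integrand is at most |V_{φ₁}φ(w)| v(w) ‖φ₁‖_{M¹_v}. The same estimate supplies
the absolute integrability for Fubini. -/
theorem integrable_smul_M1embed_shift {d : ℕ} {v : E d × E d → ℝ} (hv : IsSubmultWeight v)
    (φ₁ : M1 v) (φ : L2 d) (hint : Integrable fun w => stft φ₁ φ w * (v w : ℂ)) :
    Integrable fun w => stft φ₁ φ w • M1embed v (M1shift hv w φ₁) := by
  refine (hint.norm.mul_const (M1norm v φ₁)).mono'
    ((stronglyMeasurable_stft _ _).smul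
      (stronglyMeasurable_M1embed_shift hv φ₁)).aestronglyMeasurable
    (Eventually.of_forall fun w => ?_)
  rw [norm_smul, norm_M1embed hv, norm_mul, Complex.norm_real, Real.norm_of_nonneg (hv.nonneg w),
    mul_assoc]
  exact mul_le_mul_of_nonneg_left (M1norm_tfShift_le hv φ₁.2 w) (norm_nonneg _)

theorem stronglyMeasurable_stft_mul_stft_tfShift {d : ℕ} {v : E d × E d → ℝ}
    (hv : IsSubmultWeight v) (φ₁ φ χ : L2 d) :
    StronglyMeasurable fun w : (E d × E d) × (E d × E d) =>
      stft φ₁ φ w.1 * (stft χ (tfShift w.1 φ₁) w.2 * (v w.2 : ℂ)) :=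
  ((stronglyMeasurable_stft _ _).comp_measurable measurable_fst).mul
    ((stronglyMeasurable_stft_tfShift χ φ₁).mul
      (hv.measurable_ofReal.comp measurable_snd).stronglyMeasurable)

theorem integral_norm_stft_mul_stft_tfShift {d : ℕ} {v : E d × E d → ℝ}
    (hv : IsSubmultWeight v) (φ₁ : M1 v) (φ : L2 d) (w : E d × E d) :
    ∫ x, ‖stft φ₁ φ w * (stft (gaussian d) (tfShift w φ₁) x * (v x : ℂ))‖
      = ‖stft φ₁ φ w‖ * M1norm v (tfShift w φ₁) := by
  rw [M1norm, ← integral_const_mul]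
  refine integral_congr_ae (Eventually.of_forall fun x => ?_)
  simp only [norm_mul, Complex.norm_real, Real.norm_of_nonneg (hv.nonneg x)]

theorem integrable_stft_mul_stft_tfShift_prod {d : ℕ} {v : E d × E d → ℝ}
    (hv : IsSubmultWeight v) (φ₁ : M1 v) (φ : L2 d)
    (hint : Integrable fun w => stft φ₁ φ w * (v w : ℂ)) :
    Integrable (fun w : (E d × E d) × (E d × E d) =>
      stft φ₁ φ w.1 * (stft (gaussian d) (tfShift w.1 φ₁) w.2 * (v w.2 : ℂ)))
      (volume.prod volume) := by
  have h5 : ∀ w, Integrable fun x =>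
      stft φ₁ φ w * (stft (gaussian d) (tfShift w φ₁) x * (v x : ℂ)) := by
    intro w
    have h := (integrable_stft_tfShift_mul_weight hv w φ₁).const_mul (stft φ₁ φ w)
    exact h
  have hF := (integrable_smul_M1embed_shift hv φ₁ φ hint).norm
  simp only [norm_smul, norm_M1embed hv] at hF
  rw [integrable_prod_iff
    (stronglyMeasurable_stft_mul_stft_tfShift hv _ _ _).aestronglyMeasurable]
  refine ⟨Eventually.of_forall h5, ?_⟩
  simp only [integral_norm_stft_mul_stft_tfShift hv]
  exact hF

/-- The inversion formula ∫ V_{φ₁}φ(w) π(w)φ₁ dw = ‖φ₁‖² φ, read in L¹ through the embedding. Both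
sides are compared on set integrals: Fubini brings the w-integral inside, where Moyal's identity
evaluates it. -/
theorem integral_smul_M1embed_shift {d : ℕ} {v : E d × E d → ℝ} (hv : IsSubmultWeight v)
    (φ₁ φ : M1 v) (hint : Integrable fun w => stft φ₁ φ w * (v w : ℂ)) :
    ∫ w, stft φ₁ φ w • M1embed v (M1shift hv w φ₁)
      = ((‖(φ₁ : L2 d)‖ : ℂ) ^ 2) • M1embed v φ := by
  have hF := integrable_smul_M1embed_shift hv φ₁ φ hint
  refine Lp.ext (Integrable.ae_eq_of_forall_setIntegral_eq _ _ (L1.integrable_coeFn _)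
    (L1.integrable_coeFn _) fun s hs _ => ?_)
  obtain ⟨L, hL⟩ := exists_setIntegralCLM (volume : Measure (E d × E d)) s
  rw [← hL, ← hL, ← L.integral_comp_comm hF, map_smul, hL, smul_eq_mul]
  have h1 : ∀ w, L (stft φ₁ φ w • M1embed v (M1shift hv w φ₁))
      = ∫ x in s, stft φ₁ φ w * (stft (gaussian d) (tfShift w φ₁) x * (v x : ℂ)) := by
    intro w
    rw [map_smul, hL, smul_eq_mul, ← integral_const_mul]
    refine integral_congr_ae ?_
    filter_upwards [ae_restrict_of_ae (coeFn_M1embed (M1shift hv w φ₁))] with x hx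
    rw [hx]
    rfl
  simp_rw [h1]
  have hprod : Integrable (Function.uncurry fun w x =>
      stft φ₁ φ w * (stft (gaussian d) (tfShift w φ₁) x * (v x : ℂ)))
      (volume.prod (volume.restrict s)) :=
    (integrable_stft_mul_stft_tfShift_prod hv φ₁ φ hint).mono_measure
      (Measure.prod_mono le_rfl Measure.restrict_le_self)
  rw [integral_integral_swap hprod, ← integral_const_mul]
  refine integral_congr_ae ?_
  filter_upwards [ae_restrict_of_ae (coeFn_M1embed φ)] with x hx
  rw [hx]
  simp_rw [← mul_assoc]
  rw [integral_mul_const, integral_stft_mul_stft_tfShift]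

/-- The reproducing formula on `(M¹_v)'`. -/
theorem reproducing_formula {d : ℕ} {v : E d × E d → ℝ} (hv : IsSubmultWeight v)
    (φ₁ φ : M1 v) (hint : Integrable fun w => stft φ₁ φ w * (v w : ℂ)) (ψ : M1dual v) :
    (‖(φ₁ : L2 d)‖ : ℂ) ^ 2 * ψ.1 φ = ∫ w, conj (stft φ₁ φ w) * dualStft hv φ₁ ψ w := by
  obtain ⟨Λ, hΛ⟩ := exists_dual_extension hv ψ
  have h1 := Λ.integral_comp_comm (integrable_smul_M1embed_shift hv φ₁ φ hint)
  rw [integral_smul_M1embed_shift hv φ₁ φ hint, map_smul, smul_eq_mul] at h1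
  have h2 := congrArg conj h1
  rw [← integral_conj, map_mul, ← hΛ, map_pow, Complex.conj_ofReal] at h2
  rw [← h2]
  refine integral_congr_ae (Eventually.of_forall fun w => ?_)
  simp only [dualStft]
  rw [hΛ, map_smul, smul_eq_mul, map_mul]

theorem integrable_stft_tfShift {d : ℕ} {v : E d × E d → ℝ} (hv : IsSubmultWeight v)
    {φ₁ φ : L2 d} (hint : Integrable fun w => stft φ₁ φ w * (v w : ℂ)) (z : E d × E d) :
    Integrable fun w => stft φ₁ (tfShift z φ) w * (v w : ℂ) := by
  refine ((hint.comp_sub_right z).norm.const_mul (v z)).mono'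
    ((stronglyMeasurable_stft _ _).measurable.mul hv.measurable_ofReal).aestronglyMeasurable
    (Eventually.of_forall fun w => ?_)
  simp only [norm_mul, norm_stft_tfShift, Complex.norm_real, Real.norm_of_nonneg (hv.nonneg _)]
  nlinarith [mul_le_mul_of_nonneg_left (hv.le_mul_sub w z) (norm_nonneg (stft φ₁ φ (w - z)))]

/-- Change of window: `|V_φ ψ|` is dominated by the convolution of `|V_{φ₁} ψ|` with
`|V_{φ₁} φ|`. -/
theorem enorm_dualStft_le {d : ℕ} {v : E d × E d → ℝ} (hv : IsSubmultWeight v)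
    (φ₁ φ : M1 v) (hint : Integrable fun w => stft φ₁ φ w * (v w : ℂ)) (ψ : M1dual v)
    (z : E d × E d) : ‖(φ₁ : L2 d)‖ₑ ^ 2 * ‖dualStft hv φ ψ z‖ₑ ≤
      ∫⁻ w, ‖stft φ₁ φ (w - z)‖ₑ * ‖dualStft hv φ₁ ψ w‖ₑ := by
  -- The formula is applied to π(z)φ, whose transform with window φ₁ has modulus |V_{φ₁}φ(w - z)|.
  have h := reproducing_formula hv φ₁ (M1shift hv z φ) (integrable_stft_tfShift hv hint z) ψ
  have h1 := congrArg (fun c : ℂ => ‖c‖ₑ) h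
  simp only [enorm_mul, enorm_pow] at h1
  have h2 : ‖((‖(φ₁ : L2 d)‖ : ℝ) : ℂ)‖ₑ = ‖(φ₁ : L2 d)‖ₑ := by
    rw [← ofReal_norm, Complex.norm_real, norm_norm, ofReal_norm]
  rw [h2] at h1
  refine h1.le.trans ((enorm_integral_le_lintegral_enorm _).trans (lintegral_mono fun w => ?_))
  rw [enorm_mul, ← ofReal_norm, RCLike.norm_conj]
  simp only [M1shift]
  rw [norm_stft_tfShift, ofReal_norm]

/-! ### Covariance of the Weyl transform -/

/-- A common modulation of both entries contributes e^{2πi z.2·t}, which shifts the frequency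
variable; a common translation shifts x. -/
theorem wigner_tfShift {d : ℕ} (ψ φ : L2 d) (z w : E d × E d) :
    wigner (tfShift z ψ) (tfShift z φ) w = wigner ψ φ (w - z) := by
  unfold wigner
  refine integral_congr_ae ?_
  filter_upwards [(quasi_add w.1).ae (coeFn_tfShift z ψ), (quasi_sub w.1).ae (coeFn_tfShift z φ)]
    with t h1 h2
  rw [h1, h2, map_mul, ← Complex.exp_conj, Prod.fst_sub, Prod.snd_sub, sub_right_comm,
    sub_add_eq_add_sub]
  have e : Complex.exp (2 * Real.pi * Complex.I * (inner ℝ z.2 (w.1 + (1 / 2 : ℝ) • t) : ℝ)) *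
      Complex.exp (conj (2 * Real.pi * Complex.I * (inner ℝ z.2 (w.1 - (1 / 2 : ℝ) • t) : ℝ))) *
      Complex.exp (-2 * Real.pi * Complex.I * (inner ℝ w.2 t : ℝ))
      = Complex.exp (-2 * Real.pi * Complex.I * (inner ℝ (w.2 - z.2) t : ℝ)) := by
    rw [← Complex.exp_add, ← Complex.exp_add]
    congr 1
    simp only [map_mul, Complex.conj_ofReal, Complex.conj_I, map_ofNat, inner_add_right,
      inner_sub_right, inner_smul_right, inner_sub_left]
    push_cast; ring
  rw [← e]
  ring

theorem coeFn_translate {d : ℕ} (z : E d × E d) (a : Lp ℂ 2 (volume : Measure (E d × E d))) :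
    translate z a =ᵐ[volume] fun w => a (w - z) :=
  Lp.coeFn_compMeasurePreserving a _

theorem coeFn_wignerL2 {d : ℕ} (ψ φ : L2 d) : wignerL2 ψ φ =ᵐ[volume] wigner ψ φ :=
  (memLp_wigner ψ φ).coeFn_toLp

theorem inner_wignerL2_tfShift_translate {d : ℕ} (ψ φ : L2 d) (z : E d × E d)
    (a : Lp ℂ 2 (volume : Measure (E d × E d))) :
    inner ℂ (wignerL2 (tfShift z ψ) (tfShift z φ)) (translate z a) = inner ℂ (wignerL2 ψ φ) a := by
  rw [L2.inner_def, L2.inner_def,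
    ← integral_sub_right_eq_self (fun w => inner ℂ (wignerL2 ψ φ w) (a w)) z]
  refine integral_congr_ae ?_
  filter_upwards [coeFn_translate z a, coeFn_wignerL2 (tfShift z ψ) (tfShift z φ),
    (measurePreserving_sub_right (volume : Measure (E d × E d)) z).quasiMeasurePreserving.ae
      (coeFn_wignerL2 ψ φ)] with w h1 h2 h3
  rw [h1, h2, h3, wigner_tfShift]

theorem tfShift_surjective {d : ℕ} (z : E d × E d) :
    Function.Surjective (tfShift z : L2 d → L2 d) :=
  (tfShiftEquiv z).surjective

/-- Covariance of the Weyl transform. -/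
theorem weyl_translate {d : ℕ} (a : Lp ℂ 2 (volume : Measure (E d × E d))) (z : E d × E d)
    (φ : L2 d) : weyl (translate z a) (tfShift z φ) = tfShift z (weyl a φ) := by
  refine ext_inner_left ℂ fun η => ?_
  obtain ⟨ψ, rfl⟩ := tfShift_surjective z η
  rw [inner_weyl, inner_wignerL2_tfShift_translate, inner_tfShift_tfShift,
    inner_weyl]

theorem adjoint_weyl_translate {d : ℕ} (a : Lp ℂ 2 (volume : Measure (E d × E d)))
    (z : E d × E d) (η : L2 d) :
    ContinuousLinearMap.adjoint (weyl (translate z a)) (tfShift z η)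
      = tfShift z (ContinuousLinearMap.adjoint (weyl a) η) := by
  refine ext_inner_left ℂ fun χ => ?_
  obtain ⟨ψ, rfl⟩ := tfShift_surjective z χ
  calc _ = inner ℂ (weyl (translate z a) (tfShift z ψ)) (tfShift z η) :=
        ContinuousLinearMap.adjoint_inner_right _ _ _
    _ = inner ℂ (tfShift z (weyl a ψ)) (tfShift z η) := by rw [weyl_translate]
    _ = inner ℂ (weyl a ψ) η := inner_tfShift_tfShift z _ _
    _ = inner ℂ ψ (ContinuousLinearMap.adjoint (weyl a) η) :=
        (ContinuousLinearMap.adjoint_inner_right _ _ _).symm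
    _ = _ := (inner_tfShift_tfShift z _ _).symm

/-! ### Nuclear decompositions and their translates -/

/-- `T = ∑ φₙ ⊗ ξₙ` is a nuclear decomposition of `T : L² → M¹_v`. -/
def IsNuclearDecomposition {d : ℕ} (v : E d × E d → ℝ) (T : L2 d →L[ℂ] L2 d) (φ : ℕ → M1 v)
    (ξ : ℕ → L2 d) : Prop :=
  Summable (fun n => M1norm v (φ n) * ‖ξ n‖) ∧
    ∀ η : L2 d, T η ∈ M1 v ∧
      Tendsto (fun N => M1norm v (T η - ∑ n ∈ Finset.range N, inner ℂ (ξ n) η • (φ n : L2 d)))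
        atTop (𝓝 0)

theorem IsNuclearDecomposition.isNuclear {d : ℕ} {v : E d × E d → ℝ} {T : L2 d →L[ℂ] L2 d}
    {φ : ℕ → M1 v} {ξ : ℕ → L2 d} (h : IsNuclearDecomposition v T φ ξ) : IsNuclear v T :=
  ⟨φ, ξ, h⟩

/-- By covariance the new operator is π(z)(L_a)*π(z)*, so both factors of every rank-one term are
shifted. The shift of ξₙ preserves norms, and that of φₙ costs at most v(z), in the summability and
in the convergence of the series alike. -/
theorem IsNuclearDecomposition.translate {d : ℕ} {v : E d × E d → ℝ} (hv : IsSubmultWeight v)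
    {a : Lp ℂ 2 (volume : Measure (E d × E d))} {φ : ℕ → M1 v} {ξ : ℕ → L2 d}
    (h : IsNuclearDecomposition v (ContinuousLinearMap.adjoint (weyl a)) φ ξ) (z : E d × E d) :
    IsNuclearDecomposition v (ContinuousLinearMap.adjoint (weyl (translate z a)))
      (fun n => M1shift hv z (φ n)) (fun n => tfShift z (ξ n)) := by
  refine ⟨(h.1.mul_left (v z)).of_nonneg_of_le
    (fun n => mul_nonneg (M1norm_nonneg hv _) (norm_nonneg _)) fun n => ?_, fun χ => ?_⟩
  · rw [norm_tfShift, ← mul_assoc]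
    exact mul_le_mul_of_nonneg_right (M1norm_tfShift_le hv (φ n).2 z) (norm_nonneg _)
  · obtain ⟨η, rfl⟩ := tfShift_surjective z χ
    rw [adjoint_weyl_translate]
    refine ⟨tfShift_mem_M1 hv z (h.2 η).1, ?_⟩
    have h1 : ∀ N, tfShift z (ContinuousLinearMap.adjoint (weyl a) η) -
        ∑ n ∈ Finset.range N, inner ℂ (tfShift z (ξ n)) (tfShift z η) • (M1shift hv z (φ n) : L2 d)
        = tfShift z (ContinuousLinearMap.adjoint (weyl a) η -
          ∑ n ∈ Finset.range N, inner ℂ (ξ n) η • (φ n : L2 d)) := by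
      intro N
      simp only [← tfShiftEquiv_apply, map_sub, map_sum, map_smul]
      congr 1
      refine Finset.sum_congr rfl fun n _ => ?_
      rw [tfShiftEquiv_apply, tfShiftEquiv_apply, inner_tfShift_tfShift]
      rfl
    simp_rw [h1]
    have h2 := (h.2 η).2.const_mul (v z)
    refine squeeze_zero (fun N => M1norm_nonneg hv _) (fun N => ?_)
      (h2.mono_right (by rw [mul_zero]))
    exact M1norm_tfShift_le hv ((M1 v).sub_mem (h.2 η).1
      (Submodule.sum_mem _ fun n _ => (M1 v).smul_mem _ (φ n).2)) z

/-- The series for T η converges in the norm for which ψ is bounded, so ψ may be applied termwise;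
the resulting series in L² converges absolutely by nuclearity. It makes explicit an adjoint that was
defined without reference to a decomposition. -/
theorem IsNuclearDecomposition.hasSum_dualAdjoint {d : ℕ} {v : E d × E d → ℝ}
    (hv : IsSubmultWeight v) {T : L2 d →L[ℂ] L2 d} {φ : ℕ → M1 v} {ξ : ℕ → L2 d}
    (h : IsNuclearDecomposition v T φ ξ) (hT : IsNuclear v T) (ψ : M1dual v) :
    HasSum (fun n => ψ.1 (φ n) • ξ n) (dualAdjoint hv hT ψ) := by
  obtain ⟨C, hC⟩ := ψ.2
  have hs : Summable fun n => ψ.1 (φ n) • ξ n := by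
    refine Summable.of_norm_bounded (h.1.mul_left C) fun n => ?_
    rw [norm_smul, ← mul_assoc]
    exact mul_le_mul_of_nonneg_right (hC _) (norm_nonneg _)
  have heq : ∑' n, ψ.1 (φ n) • ξ n = dualAdjoint hv hT ψ := by
    refine ext_inner_left ℂ fun η => ?_
    rw [inner_dualAdjoint]
    have h1 : Tendsto (fun N => inner ℂ η (∑ n ∈ Finset.range N, ψ.1 (φ n) • ξ n)) atTop
        (𝓝 (inner ℂ η (∑' n, ψ.1 (φ n) • ξ n))) :=
      ((continuous_const.inner continuous_id).tendsto _).comp hs.hasSum.tendsto_sum_nat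
    refine tendsto_nhds_unique h1 ?_
    rw [tendsto_iff_norm_sub_tendsto_zero]
    have h2 := (h.2 η).2.const_mul C
    refine squeeze_zero (fun N => norm_nonneg _) (fun N => ?_)
      (h2.mono_right (by rw [mul_zero]))
    have h3 : inner ℂ η (∑ n ∈ Finset.range N, ψ.1 (φ n) • ξ n)
        = ψ.1 (∑ n ∈ Finset.range N, inner ℂ (ξ n) η • φ n) := by
      rw [inner_sum, map_sum]
      refine Finset.sum_congr rfl fun n _ => ?_
      rw [inner_smul_right, LinearMap.map_smulₛₗ, inner_conj_symm, smul_eq_mul, mul_comm]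
    rw [h3, ← norm_neg, neg_sub, ← map_sub]
    refine (hC _).trans (le_of_eq ?_)
    congr 2
    simp
  rw [← heq]
  exact hs.hasSum

/-! ### Injectivity of the Weyl transform -/

/-- The positive and negative parts of g are densities of finite measures with equal characteristic
functions. The measures coincide, hence so do the densities almost everywhere. -/
theorem ae_eq_zero_of_integral_cexp_real {V : Type*} [NormedAddCommGroup V] [NormedSpace ℝ V]
    [CompleteSpace V] [MeasurableSpace V] [BorelSpace V] [SecondCountableTopology V]
    {μ : Measure V} {g : V → ℝ} (hg : Integrable g μ)
    (h : ∀ L : StrongDual ℝ V, ∫ y, (g y : ℂ) * Complex.exp (L y * Complex.I) ∂μ = 0) :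
    g =ᵐ[μ] 0 := by
  have key : ∀ f : V → ℝ, Integrable f μ → ∀ L : StrongDual ℝ V,
      charFunDual (μ.withDensity fun y => ENNReal.ofReal (f y)) L
        = ∫ y, ((max (f y) 0 : ℝ) : ℂ) * Complex.exp (L y * Complex.I) ∂μ := by
    intro f hf L
    rw [charFunDual_apply, integral_withDensity_eq_integral_toReal_smul₀
      hf.1.aemeasurable.ennreal_ofReal (Eventually.of_forall fun y => ENNReal.ofReal_lt_top)]
    refine integral_congr_ae (Eventually.of_forall fun y => ?_)
    simp only [ENNReal.toReal_ofReal', Complex.real_smul]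
  have hint : ∀ f : V → ℝ, Integrable f μ → ∀ L : StrongDual ℝ V,
      Integrable (fun y => ((max (f y) 0 : ℝ) : ℂ) * Complex.exp (L y * Complex.I)) μ := by
    intro f hf L
    refine hf.pos_part.ofReal.mul_bdd (c := 1) ?_ (Eventually.of_forall fun y => ?_)
    · have hL := L.continuous
      exact (by fun_prop : Continuous fun y => Complex.exp (L y * Complex.I)).aestronglyMeasurable
    · rw [Complex.norm_exp_ofReal_mul_I]
  have hfin : ∀ f : V → ℝ, Integrable f μ →
      IsFiniteMeasure (μ.withDensity fun y => ENNReal.ofReal (f y)) := fun f hf =>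
    isFiniteMeasure_withDensity_ofReal hf.2
  have hng : Integrable (fun y => -g y) μ := hg.neg
  have := hfin g hg
  have := hfin _ hng
  have heq : μ.withDensity (fun y => ENNReal.ofReal (g y))
      = μ.withDensity (fun y => ENNReal.ofReal (-g y)) := by
    refine Measure.ext_of_charFunDual (funext fun L => ?_)
    rw [key g hg, key _ hng, ← sub_eq_zero,
      ← integral_sub (hint g hg L) (hint _ hng L), ← h L]
    refine integral_congr_ae (Eventually.of_forall fun y => ?_)
    simp only [← sub_mul, ← Complex.ofReal_sub]
    rw [max_zero_sub_max_neg_zero_eq_self]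
  rw [withDensity_eq_iff hg.1.aemeasurable.ennreal_ofReal hng.1.aemeasurable.ennreal_ofReal
    (by simpa using (hfin g hg).measure_univ_lt_top.ne)] at heq
  filter_upwards [heq] with y hy
  have h1 := congrArg ENNReal.toReal hy
  rw [ENNReal.toReal_ofReal', ENNReal.toReal_ofReal'] at h1
  have h2 : max (g y) 0 - max (-g y) 0 = g y := max_zero_sub_max_neg_zero_eq_self (g y)
  rw [h1, sub_self] at h2
  exact h2.symm

/-- An integrable function with vanishing Fourier transform vanishes. -/
theorem ae_eq_zero_of_integral_cexp {V : Type*} [NormedAddCommGroup V] [NormedSpace ℝ V]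
    [CompleteSpace V] [MeasurableSpace V] [BorelSpace V] [SecondCountableTopology V]
    {μ : Measure V} {f : V → ℂ} (hf : Integrable f μ)
    (h : ∀ L : StrongDual ℝ V, ∫ y, f y * Complex.exp (L y * Complex.I) ∂μ = 0) :
    f =ᵐ[μ] 0 := by
  have hexp : ∀ L : StrongDual ℝ V, ∀ g : V → ℂ, Integrable g μ →
      Integrable (fun y => g y * Complex.exp (L y * Complex.I)) μ := by
    intro L g hg
    refine hg.mul_bdd (c := 1) ?_ (Eventually.of_forall fun y => ?_)
    · have hL := L.continuous
      exact (by fun_prop : Continuous fun y => Complex.exp (L y * Complex.I)).aestronglyMeasurable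
    · rw [Complex.norm_exp_ofReal_mul_I]
  have hconj : Integrable (fun y => conj (f y)) μ :=
    hf.mono (Complex.continuous_conj.comp_aestronglyMeasurable hf.1)
      (Eventually.of_forall fun y => (RCLike.norm_conj _).le)
  -- The transform of conj f at L is the conjugate of that of f at -L. Hence the transforms of the
  -- real and imaginary parts vanish too.
  have h' : ∀ L : StrongDual ℝ V, ∫ y, conj (f y) * Complex.exp (L y * Complex.I) ∂μ = 0 := by
    intro L
    have h1 := congrArg conj (h (-L))
    rw [← integral_conj, map_zero] at h1
    rw [← h1]
    refine integral_congr_ae (Eventually.of_forall fun y => ?_)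
    simp only [map_mul, ← Complex.exp_conj, Complex.conj_ofReal, Complex.conj_I]
    congr 2
    simp
  have hre : (fun y => (f y).re) =ᵐ[μ] 0 := by
    refine ae_eq_zero_of_integral_cexp_real hf.re fun L => ?_
    have h1 : ∫ y, ((f y * Complex.exp (L y * Complex.I)) +
        (conj (f y) * Complex.exp (L y * Complex.I))) ∂μ = 0 := by
      rw [integral_add (hexp L f hf) (hexp L _ hconj), h, h', add_zero]
    have h2 : ∫ y, ((f y).re : ℂ) * Complex.exp (L y * Complex.I) ∂μ
        = (1 / 2 : ℂ) * ∫ y, ((f y * Complex.exp (L y * Complex.I)) +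
        (conj (f y) * Complex.exp (L y * Complex.I))) ∂μ := by
      rw [← integral_const_mul]
      refine integral_congr_ae (Eventually.of_forall fun y => ?_)
      simp only [Complex.re_eq_add_conj]
      ring
    rw [h2, h1, mul_zero]
  have him : (fun y => (f y).im) =ᵐ[μ] 0 := by
    refine ae_eq_zero_of_integral_cexp_real hf.im fun L => ?_
    have h1 : ∫ y, ((f y * Complex.exp (L y * Complex.I)) -
        (conj (f y) * Complex.exp (L y * Complex.I))) ∂μ = 0 := by
      rw [integral_sub (hexp L f hf) (hexp L _ hconj), h, h', sub_zero]
    have h2 : ∫ y, ((f y).im : ℂ) * Complex.exp (L y * Complex.I) ∂μ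
        = (1 / (2 * Complex.I) : ℂ) * ∫ y, ((f y * Complex.exp (L y * Complex.I)) -
        (conj (f y) * Complex.exp (L y * Complex.I))) ∂μ := by
      rw [← integral_const_mul]
      refine integral_congr_ae (Eventually.of_forall fun y => ?_)
      simp only [Complex.im_eq_sub_conj]
      ring
    rw [h2, h1, mul_zero]
  filter_upwards [hre, him] with y h1 h2
  exact Complex.ext h1 h2

/-- Opposite modulations combine to e^{4πi u.2·x}; opposite translations replace t by t - 2u.1,
which costs e^{-4πi u.1·ω}. Such shifts thus multiply W(ψ, φ) by a character, and every character of
phase space arises. -/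
theorem wigner_tfShift_neg {d : ℕ} (ψ φ : L2 d) (u w : E d × E d) :
    wigner (tfShift u ψ) (tfShift (-u) φ) w =
      Complex.exp (4 * Real.pi * Complex.I * ((inner ℝ u.2 w.1 : ℝ) - (inner ℝ u.1 w.2 : ℝ))) *
        wigner ψ φ w := by
  unfold wigner
  rw [← integral_const_mul, ← integral_sub_right_eq_self (fun t : E d => Complex.exp
    (4 * Real.pi * Complex.I * ((inner ℝ u.2 w.1 : ℝ) - (inner ℝ u.1 w.2 : ℝ))) *
      (ψ (w.1 + (1 / 2 : ℝ) • t) * conj (φ (w.1 - (1 / 2 : ℝ) • t)) *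
        Complex.exp (-2 * Real.pi * Complex.I * (inner ℝ w.2 t : ℝ)))) ((2 : ℝ) • u.1)]
  refine integral_congr_ae ?_
  filter_upwards [(quasi_add w.1).ae (coeFn_tfShift u ψ),
    (quasi_sub w.1).ae (coeFn_tfShift (-u) φ)] with t h1 h2
  have e1 : w.1 + (1 / 2 : ℝ) • (t - (2 : ℝ) • u.1) = w.1 + (1 / 2 : ℝ) • t - u.1 := by module
  have e2 : w.1 - (1 / 2 : ℝ) • (t - (2 : ℝ) • u.1) = w.1 - (1 / 2 : ℝ) • t - (-u).1 := by
    rw [Prod.fst_neg]; module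
  rw [h1, h2, e1, e2, map_mul, ← Complex.exp_conj]
  have e : Complex.exp (2 * Real.pi * Complex.I * (inner ℝ u.2 (w.1 + (1 / 2 : ℝ) • t) : ℝ)) *
      Complex.exp (conj (2 * Real.pi * Complex.I *
        (inner ℝ (-u).2 (w.1 - (1 / 2 : ℝ) • t) : ℝ))) *
      Complex.exp (-2 * Real.pi * Complex.I * (inner ℝ w.2 t : ℝ))
      = Complex.exp (4 * Real.pi * Complex.I * ((inner ℝ u.2 w.1 : ℝ) - (inner ℝ u.1 w.2 : ℝ))) *
        Complex.exp (-2 * Real.pi * Complex.I * (inner ℝ w.2 (t - (2 : ℝ) • u.1) : ℝ)) := by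
    rw [← Complex.exp_add, ← Complex.exp_add, ← Complex.exp_add]
    congr 1
    simp only [map_mul, Complex.conj_ofReal, Complex.conj_I, map_ofNat, inner_add_right,
      inner_sub_right, inner_smul_right, Prod.snd_neg, inner_neg_left, real_inner_comm w.2 u.1]
    push_cast; ring
  linear_combination (ψ (w.1 + (1 / 2 : ℝ) • t - u.1) *
    conj (φ (w.1 - (1 / 2 : ℝ) • t - (-u).1))) * e

/-- By the parallelogram law, φ₀(x + t/2) φ₀(x - t/2) is a Gaussian in x times a Gaussian in t, so
its Fourier transform in t is a Gaussian without zeros. -/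
theorem wigner_gaussian_ne_zero {d : ℕ} (w : E d × E d) :
    wigner (gaussian d) (gaussian d) w ≠ 0 := by
  have hg := (memLp_gaussian d).coeFn_toLp
  have h1 : wigner (gaussian d) (gaussian d) w = ∫ t : E d,
      ((((2 : ℝ) ^ (d / 4 : ℝ)) ^ 2 * Real.exp (-2 * Real.pi * ‖w.1‖ ^ 2) : ℝ) : ℂ) *
        Complex.exp (-(Real.pi / 2 : ℂ) * ‖t‖ ^ 2 +
          (-2 * Real.pi * Complex.I) * (inner ℝ w.2 t : ℝ)) := by
    unfold wigner
    refine integral_congr_ae ?_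
    filter_upwards [(quasi_add w.1).ae hg, (quasi_sub w.1).ae hg] with t h1 h2
    rw [gaussian, h1, h2, Complex.conj_ofReal, Complex.exp_add, ← mul_assoc]
    congr 1
    have e : gaussianFun d (w.1 + (1 / 2 : ℝ) • t) * gaussianFun d (w.1 - (1 / 2 : ℝ) • t)
        = ((2 : ℝ) ^ (d / 4 : ℝ)) ^ 2 * Real.exp (-2 * Real.pi * ‖w.1‖ ^ 2) *
          Real.exp (-(Real.pi / 2) * ‖t‖ ^ 2) := by
      have e1 : ‖w.1 + (1 / 2 : ℝ) • t‖ ^ 2 + ‖w.1 - (1 / 2 : ℝ) • t‖ ^ 2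
          = 2 * ‖w.1‖ ^ 2 + ‖t‖ ^ 2 / 2 := by
        rw [norm_add_sq_real, norm_sub_sq_real, norm_smul]
        norm_num; ring
      have e2 : Real.exp (-Real.pi * ‖w.1 + (1 / 2 : ℝ) • t‖ ^ 2) *
          Real.exp (-Real.pi * ‖w.1 - (1 / 2 : ℝ) • t‖ ^ 2)
          = Real.exp (-2 * Real.pi * ‖w.1‖ ^ 2) * Real.exp (-(Real.pi / 2) * ‖t‖ ^ 2) := by
        rw [← Real.exp_add, ← Real.exp_add]
        congr 1
        linear_combination (-Real.pi) * e1
      rw [gaussianFun, gaussianFun]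
      linear_combination ((2 : ℝ) ^ (d / 4 : ℝ)) ^ 2 * e2
    rw [← Complex.ofReal_mul, e]
    push_cast
    ring
  rw [h1, integral_const_mul, GaussianFourier.integral_cexp_neg_mul_sq_norm_add
    (by simp [Real.pi_pos])]
  have hpi : (Real.pi : ℂ) ≠ 0 := by exact_mod_cast Real.pi_ne_zero
  refine mul_ne_zero ?_ (mul_ne_zero ?_ (Complex.exp_ne_zero _))
  · rw [Complex.ofReal_ne_zero]
    positivity
  · rw [Ne, Complex.cpow_eq_zero_iff, not_and_or]
    left
    field_simp
    norm_num

/-- The Weyl transform is injective. -/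
theorem weyl_ne_zero {d : ℕ} {a : Lp ℂ 2 (volume : Measure (E d × E d))} (ha : a ≠ 0) :
    weyl a ≠ 0 := by
  intro h0
  apply ha
  have hW : ∀ ψ φ : L2 d, ∫ w, a w * conj (wigner ψ φ w) = 0 := by
    intro ψ φ
    have h1 := inner_weyl a φ ψ
    rw [h0, zero_apply, inner_zero_right, L2.inner_def] at h1
    rw [h1]
    refine integral_congr_ae ?_
    filter_upwards [coeFn_wignerL2 ψ φ] with w hw
    rw [hw, RCLike.inner_apply]
  -- If L_a = 0, then a is orthogonal to all W(π(u)φ₀, π(-u)φ₀), that is, the integrable function a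
  -- · conj W(φ₀, φ₀) has zero Fourier transform. It vanishes a.e., and its second factor has no
  -- zeros.
  have hint : Integrable fun w => a w * conj (wigner (gaussian d) (gaussian d) w) :=
    (Lp.memLp a).integrable_mul (memLp_wigner (gaussian d) (gaussian d)).star
  have hz : (fun w => a w * conj (wigner (gaussian d) (gaussian d) w)) =ᵐ[volume] 0 := by
    refine ae_eq_zero_of_integral_cexp hint fun L => ?_
    set p := (InnerProductSpace.toDual ℝ (E d)).symm (L.comp (.inl ℝ (E d) (E d)))
    set q := (InnerProductSpace.toDual ℝ (E d)).symm (L.comp (.inr ℝ (E d) (E d)))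
    have hL : ∀ w : E d × E d, L w = inner ℝ p w.1 + inner ℝ q w.2 := by
      intro w
      rw [InnerProductSpace.toDual_symm_apply, InnerProductSpace.toDual_symm_apply,
        ContinuousLinearMap.comp_apply, ContinuousLinearMap.comp_apply, ← map_add]
      simp
    -- The shift u = (q, -p)/(4π) solves 4π(u.2·x - u.1·ω) = -(p·x + q·ω); the sign is reversed by
    -- the conjugation of W.
    have h1 := hW (tfShift ((4 * Real.pi)⁻¹ • q, -(4 * Real.pi)⁻¹ • p) (gaussian d))
      (tfShift (-((4 * Real.pi)⁻¹ • q, -(4 * Real.pi)⁻¹ • p)) (gaussian d))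
    rw [← h1]
    refine integral_congr_ae (Eventually.of_forall fun w => ?_)
    simp only [wigner_tfShift_neg]
    rw [map_mul, ← Complex.exp_conj, hL]
    have hpi : (Real.pi : ℂ) ≠ 0 := by exact_mod_cast Real.pi_ne_zero
    have e : conj (4 * Real.pi * Complex.I * ((inner ℝ (-(4 * Real.pi)⁻¹ • p) w.1 : ℝ) -
        (inner ℝ ((4 * Real.pi)⁻¹ • q) w.2 : ℝ)) : ℂ)
        = (inner ℝ p w.1 + inner ℝ q w.2 : ℝ) * Complex.I := by
      simp only [map_mul, map_sub, Complex.conj_ofReal, Complex.conj_I, map_ofNat,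
        real_inner_smul_left]
      push_cast
      field_simp
      ring
    rw [e]
    ring
  refine (Lp.eq_zero_iff_ae_eq_zero).2 ?_
  filter_upwards [hz] with w hw
  have h2 : conj (wigner (gaussian d) (gaussian d) w) ≠ 0 := by
    rw [Ne, map_eq_zero]
    exact wigner_gaussian_ne_zero w
  exact (mul_eq_zero.1 hw).resolve_right h2

/-! ### Comparison of windows in the modulation norms -/

theorem norm_gaussian (d : ℕ) : ‖gaussian d‖ = 1 := by
  have h := stft_gaussian (0 : E d × E d)
  rw [stft, tfShift_zero, inner_self_eq_norm_sq_to_K] at h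
  have h1 : ((‖gaussian d‖ ^ 2 : ℝ) : ℂ) = ((1 : ℝ) : ℂ) := by
    push_cast
    refine h.trans ?_
    simp
  have h2 : ‖gaussian d‖ ^ 2 = 1 := Complex.ofReal_injective h1
  nlinarith [norm_nonneg (gaussian d)]

theorem lintegral_enorm_stft_mul_weight {d : ℕ} {v : E d × E d → ℝ} (hv : IsSubmultWeight v)
    (φ f : L2 d) : ∫⁻ u, ‖stft φ f u‖ₑ * ENNReal.ofReal (v u)
      = ∫⁻ u, ‖stft φ f u * (v u : ℂ)‖ₑ := by
  refine lintegral_congr fun u => ?_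
  rw [enorm_mul, ← ofReal_norm (v u : ℂ), Complex.norm_real, Real.norm_of_nonneg (hv.nonneg u)]

theorem lintegral_enorm_stft_gaussian {d : ℕ} {v : E d × E d → ℝ} (hv : IsSubmultWeight v)
    (φ : M1 v) : ∫⁻ u, ‖stft (gaussian d) φ u‖ₑ * ENNReal.ofReal (v u)
      = ENNReal.ofReal (M1norm v φ) := by
  rw [lintegral_enorm_stft_mul_weight hv,
    ← ofReal_integral_norm_eq_lintegral_enorm (integrable_stft_mul_weight φ), M1norm]
  congr 1
  refine integral_congr_ae (Eventually.of_forall fun z => ?_)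
  simp only [norm_mul, Complex.norm_real, Real.norm_of_nonneg (hv.nonneg z)]

/-- Exchanging window and function reflects the argument, and v is even. -/
theorem integrable_stft_gaussian_right {d : ℕ} {v : E d × E d → ℝ} (hv : IsSubmultWeight v)
    (φ : M1 v) : Integrable fun w => stft φ (gaussian d) w * (v w : ℂ) := by
  refine ((integrable_stft_mul_weight φ).comp_smul (R := (-1 : ℝ)) (by norm_num)).mono
    ((stronglyMeasurable_stft _ _).measurable.mul hv.measurable_ofReal).aestronglyMeasurable
    (Eventually.of_forall fun w => ?_)
  rw [norm_mul, norm_mul, norm_stft_swap, neg_one_smul, hv.neg]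

theorem measurable_enorm_stft {d : ℕ} (φ f : L2 d) : Measurable fun u => ‖stft φ f u‖ₑ :=
  (stronglyMeasurable_stft φ f).measurable.enorm

theorem measurable_norm_dualStft {d : ℕ} {v : E d × E d → ℝ} (hv : IsSubmultWeight v)
    (φ : M1 v) (ψ : M1dual v) : Measurable fun u => ‖dualStft hv φ ψ u‖ :=
  (stronglyMeasurable_dualStft hv φ ψ).measurable.norm

theorem measurable_enorm_dualStft {d : ℕ} {v : E d × E d → ℝ} (hv : IsSubmultWeight v)
    (φ : M1 v) (ψ : M1dual v) : Measurable fun u => ‖dualStft hv φ ψ u‖ₑ :=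
  (stronglyMeasurable_dualStft hv φ ψ).measurable.enorm

theorem coe_M1gaussian {d : ℕ} {v : E d × E d → ℝ} (hv : IsSubmultWeight v) :
    (M1gaussian hv : L2 d) = gaussian d :=
  rfl

theorem enorm_dualStft_gaussian_le {d : ℕ} {v : E d × E d → ℝ} (hv : IsSubmultWeight v)
    (φ₁ : M1 v) (ψ : M1dual v) (z : E d × E d) :
    ‖(φ₁ : L2 d)‖ₑ ^ 2 * ‖dualStft hv (M1gaussian hv) ψ z‖ₑ ≤
      ∫⁻ w, ‖stft φ₁ (gaussian d) (w - z)‖ₑ * ‖dualStft hv φ₁ ψ w‖ₑ := by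
  have hint := integrable_stft_gaussian_right hv φ₁
  rw [← coe_M1gaussian hv] at hint ⊢
  exact enorm_dualStft_le hv φ₁ (M1gaussian hv) hint ψ z

/-- The modulation space norm is dominated by the norm computed with any other window. -/
theorem modNorm_le_of_window {d : ℕ} {v m : E d × E d → ℝ} (hv : IsSubmultWeight v)
    (hm : IsModerate v m) (φ₁ : M1 v) : ∃ B : ℝ, 0 ≤ B ∧ ∀ p q : ℝ≥0∞, 1 ≤ p → 1 ≤ q →
      ∀ ψ : M1dual v, ‖(φ₁ : L2 d)‖ₑ ^ 2 * modNorm hv p q m ψ ≤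
        ENNReal.ofReal B * mixedNorm p q m fun z => ‖dualStft hv φ₁ ψ z‖ := by
  obtain ⟨C, hC, hY⟩ := mixedNorm_young hv hm
  have hint := integrable_stft_gaussian_right hv φ₁
  have hAt : ∫⁻ u, ‖stft φ₁ (gaussian d) u‖ₑ * ENNReal.ofReal (v u) ≠ ∞ := by
    rw [lintegral_enorm_stft_mul_weight hv]
    exact hint.2.ne
  -- The constant is the Young constant times the L¹_v norm of V_{φ₁}φ₀. As ‖φ₁‖² stays on the left,
  -- a zero window needs no exclusion.
  refine ⟨C * (∫⁻ u, ‖stft φ₁ (gaussian d) u‖ₑ * ENNReal.ofReal (v u)).toReal, by positivity,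
    fun p q hp hq ψ => ?_⟩
  rw [ENNReal.ofReal_mul hC.le, ENNReal.ofReal_toReal hAt]
  have hle : ∀ z, ‖(φ₁ : L2 d)‖ₑ ^ 2 * ‖‖dualStft hv (M1gaussian hv) ψ z‖‖ₑ ≤
      ∫⁻ w, ‖stft φ₁ (gaussian d) (w - z)‖ₑ * ‖‖dualStft hv φ₁ ψ w‖‖ₑ := by
    intro z
    simp_rw [enorm_norm]
    exact enorm_dualStft_gaussian_le hv φ₁ ψ z
  have hKm := measurable_enorm_stft (φ₁ : L2 d) (gaussian d)
  have hGm := measurable_norm_dualStft hv φ₁ ψ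
  have hct : ‖(φ₁ : L2 d)‖ₑ ^ 2 ≠ ∞ := ENNReal.pow_ne_top enorm_ne_top
  exact hY p q hp hq _ _ _ _ hct hKm hGm hle

/-! ### The upper bound -/

section Decomposition

variable {d : ℕ} {v : E d × E d → ℝ} {a : Lp ℂ 2 (volume : Measure (E d × E d))}
  {φ : ℕ → M1 v} {ξ : ℕ → L2 d}

/-- Pairing ψ with the shifted vectors π(z)φₙ is by definition V_{φₙ}ψ(z). Measurability in z and
the upper bound are both read off this series. -/
theorem IsNuclearDecomposition.hasSum_extend (hv : IsSubmultWeight v)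
    (h : IsNuclearDecomposition v (ContinuousLinearMap.adjoint (weyl a)) φ ξ)
    (hT : ∀ z, IsNuclear v (ContinuousLinearMap.adjoint (weyl (TFA.translate z a))))
    (ψ : M1dual v) (z : E d × E d) :
    HasSum (fun n => dualStft hv (φ n) ψ z • tfShift z (ξ n))
      (extend hv (weyl (TFA.translate z a)) (hT z) ψ) :=
  (h.translate hv z).hasSum_dualAdjoint hv (hT z) ψ

theorem IsNuclearDecomposition.aestronglyMeasurable_extend (hv : IsSubmultWeight v)
    (h : IsNuclearDecomposition v (ContinuousLinearMap.adjoint (weyl a)) φ ξ)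
    (hT : ∀ z, IsNuclear v (ContinuousLinearMap.adjoint (weyl (TFA.translate z a))))
    (ψ : M1dual v) : AEStronglyMeasurable
      (fun z => extend hv (weyl (TFA.translate z a)) (hT z) ψ) volume := by
  refine aestronglyMeasurable_of_tendsto_ae atTop
    (f := fun N z => ∑ n ∈ Finset.range N, dualStft hv (φ n) ψ z • tfShift z (ξ n))
    (fun N => ?_) (Eventually.of_forall fun z => (h.hasSum_extend hv hT ψ z).tendsto_sum_nat)
  refine (Finset.stronglyMeasurable_fun_sum _ fun n _ => ?_).aestronglyMeasurable
  exact (stronglyMeasurable_dualStft hv (φ n) ψ).smul (stronglyMeasurable_tfShift (ξ n))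

/-- The triangle inequality in the series, a change of window from the unit vector φ₀ to each φₙ,
and Tonelli to gather the kernels into one. -/
theorem IsNuclearDecomposition.enorm_extend_le (hv : IsSubmultWeight v)
    (h : IsNuclearDecomposition v (ContinuousLinearMap.adjoint (weyl a)) φ ξ)
    (hT : ∀ z, IsNuclear v (ContinuousLinearMap.adjoint (weyl (TFA.translate z a))))
    (ψ : M1dual v) (z : E d × E d) :
    ‖extend hv (weyl (TFA.translate z a)) (hT z) ψ‖ₑ ≤
      ∫⁻ w, (∑' n, ‖ξ n‖ₑ * ‖stft (gaussian d) (φ n) (w - z)‖ₑ) *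
        ‖dualStft hv (M1gaussian hv) ψ w‖ₑ := by
  have hm : ∀ n, Measurable fun w => ‖ξ n‖ₑ * ‖stft (gaussian d) (φ n) (w - z)‖ₑ *
      ‖dualStft hv (M1gaussian hv) ψ w‖ₑ := fun n =>
    (((measurable_enorm_stft (gaussian d) (φ n : L2 d)).comp
      (measurable_sub_const z)).const_mul _).mul (measurable_enorm_dualStft hv _ ψ)
  rw [← (h.hasSum_extend hv hT ψ z).tsum_eq]
  refine (enorm_tsum_le_tsum_enorm).trans ?_
  simp_rw [← ENNReal.tsum_mul_right]
  rw [lintegral_tsum fun n => (hm n).aemeasurable]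
  refine ENNReal.tsum_le_tsum fun n => ?_
  have h1 := enorm_dualStft_le hv (M1gaussian hv) (φ n) (integrable_stft_mul_weight (φ n)) ψ z
  have h2 : ‖((M1gaussian hv : M1 v) : L2 d)‖ₑ = 1 := by
    rw [← ofReal_norm]
    exact (congrArg ENNReal.ofReal (norm_gaussian d)).trans ENNReal.ofReal_one
  rw [h2, one_pow, one_mul] at h1
  have h3 : ‖tfShift z (ξ n)‖ₑ = ‖ξ n‖ₑ := by
    rw [← ofReal_norm, norm_tfShift, ofReal_norm]
  rw [enorm_smul, h3, mul_comm]
  simp_rw [mul_assoc]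
  rw [lintegral_const_mul' _ _ enorm_ne_top]
  exact mul_le_mul_right h1 _

/-- By Tonelli the integral equals ∑ ‖ξₙ‖ ‖φₙ‖_{M¹_v}; nuclearity is exactly what puts the kernel in
L¹_v. -/
theorem IsNuclearDecomposition.lintegral_tsum_ne_top (hv : IsSubmultWeight v)
    {T : L2 d →L[ℂ] L2 d} (h : IsNuclearDecomposition v T φ ξ) :
    ∫⁻ u, (∑' n, ‖ξ n‖ₑ * ‖stft (gaussian d) (φ n) u‖ₑ) * ENNReal.ofReal (v u) ≠ ∞ := by
  have hm : ∀ n, Measurable fun u => ‖ξ n‖ₑ * ‖stft (gaussian d) (φ n) u‖ₑ *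
      ENNReal.ofReal (v u) := fun n =>
    ((measurable_enorm_stft (gaussian d) (φ n : L2 d)).const_mul _).mul
      hv.continuous.measurable.ennreal_ofReal
  simp_rw [← ENNReal.tsum_mul_right]
  rw [lintegral_tsum fun n => (hm n).aemeasurable]
  have h1 : ∀ n, ∫⁻ u, ‖ξ n‖ₑ * ‖stft (gaussian d) (φ n) u‖ₑ * ENNReal.ofReal (v u)
      = ENNReal.ofReal (M1norm v (φ n) * ‖ξ n‖) := by
    intro n
    simp_rw [mul_assoc]
    rw [lintegral_const_mul' _ _ enorm_ne_top, lintegral_enorm_stft_gaussian hv,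
      ENNReal.ofReal_mul (M1norm_nonneg hv _), mul_comm, ofReal_norm]
  simp_rw [h1]
  exact h.1.tsum_ofReal_ne_top

theorem IsNuclearDecomposition.mixedNorm_extend_le {m : E d × E d → ℝ} (hv : IsSubmultWeight v)
    (hm : IsModerate v m)
    (h : IsNuclearDecomposition v (ContinuousLinearMap.adjoint (weyl a)) φ ξ)
    (hT : ∀ z, IsNuclear v (ContinuousLinearMap.adjoint (weyl (TFA.translate z a)))) :
    ∃ B : ℝ, 0 < B ∧ ∀ p q : ℝ≥0∞, 1 ≤ p → 1 ≤ q → ∀ ψ : M1dual v,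
      mixedNorm p q m (fun z => ‖extend hv (weyl (TFA.translate z a)) (hT z) ψ‖) ≤
        ENNReal.ofReal B * modNorm hv p q m ψ := by
  obtain ⟨C, hC, hY⟩ := mixedNorm_young hv hm
  have hKm : Measurable fun u => ∑' n, ‖ξ n‖ₑ * ‖stft (gaussian d) (φ n) u‖ₑ :=
    Measurable.tsum fun n => (measurable_enorm_stft (gaussian d) (φ n : L2 d)).const_mul _
  have hAt := h.lintegral_tsum_ne_top hv
  -- The summand 1 only keeps the constant positive when the kernel vanishes.
  refine ⟨C * (∫⁻ u, (∑' n, ‖ξ n‖ₑ * ‖stft (gaussian d) (φ n) u‖ₑ) *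
    ENNReal.ofReal (v u)).toReal + 1, by positivity, fun p q hp hq ψ => ?_⟩
  have hle : ∀ z, 1 * ‖‖extend hv (weyl (TFA.translate z a)) (hT z) ψ‖‖ₑ ≤
      ∫⁻ w, (∑' n, ‖ξ n‖ₑ * ‖stft (gaussian d) (φ n) (w - z)‖ₑ) *
        ‖‖dualStft hv (M1gaussian hv) ψ w‖‖ₑ := by
    intro z
    simp_rw [enorm_norm]
    rw [one_mul]
    exact h.enorm_extend_le hv hT ψ z
  have h1 := hY p q hp hq 1 (fun u => ∑' n, ‖ξ n‖ₑ * ‖stft (gaussian d) (φ n) u‖ₑ)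
    (fun z => ‖extend hv (weyl (TFA.translate z a)) (hT z) ψ‖)
    (fun w => ‖dualStft hv (M1gaussian hv) ψ w‖)
    ENNReal.one_ne_top hKm (measurable_norm_dualStft hv (M1gaussian hv) ψ) hle
  rw [one_mul] at h1
  refine h1.trans (mul_le_mul_left ?_ _)
  rw [← ENNReal.ofReal_toReal hAt, ← ENNReal.ofReal_mul hC.le,
    ENNReal.toReal_ofReal ENNReal.toReal_nonneg]
  exact ENNReal.ofReal_le_ofReal (by linarith)

end Decomposition

/-! ### The lower bound -/

/-- By covariance ⟨L_{T_z a}ψ, π(z)η⟩ = ⟨ψ, π(z)(L_a)*η⟩, a short-time Fourier transform with window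
(L_a)*η. Cauchy–Schwarz and ‖π(z)η‖ = ‖η‖ finish. -/
theorem enorm_dualStft_adjoint_weyl_le {d : ℕ} {v : E d × E d → ℝ} (hv : IsSubmultWeight v)
    {a : Lp ℂ 2 (volume : Measure (E d × E d))}
    (hT : ∀ z, IsNuclear v (ContinuousLinearMap.adjoint (weyl (translate z a))))
    (ψ : M1dual v) (η : L2 d) (hη : ContinuousLinearMap.adjoint (weyl a) η ∈ M1 v)
    (z : E d × E d) :
    ‖dualStft hv ⟨ContinuousLinearMap.adjoint (weyl a) η, hη⟩ ψ z‖ₑ ≤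
      ‖η‖ₑ * ‖extend hv (weyl (translate z a)) (hT z) ψ‖ₑ := by
  have h1 : inner ℂ (tfShift z η) (extend hv (weyl (translate z a)) (hT z) ψ)
      = dualStft hv ⟨ContinuousLinearMap.adjoint (weyl a) η, hη⟩ ψ z :=
    (inner_dualAdjoint hv (hT z) ψ (tfShift z η)).trans
      (congrArg ψ.1 (Subtype.ext (adjoint_weyl_translate a z η)))
  have h3 := norm_inner_le_norm (𝕜 := ℂ) (tfShift z η)
    (extend hv (weyl (translate z a)) (hT z) ψ)
  rw [h1, norm_tfShift] at h3
  have h4 := ENNReal.ofReal_le_ofReal h3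
  rwa [ENNReal.ofReal_mul (norm_nonneg _), ofReal_norm, ofReal_norm, ofReal_norm] at h4

/-- Injectivity of the Weyl transform supplies a nonzero window φ₁ = (L_a)*η. The extended operators
control V_{φ₁}ψ pointwise, and V_{φ₁}ψ controls the modulation norm. -/
theorem le_mixedNorm_extend {d : ℕ} {v m : E d × E d → ℝ} (hv : IsSubmultWeight v)
    (hm : IsModerate v m) {a : Lp ℂ 2 (volume : Measure (E d × E d))} (ha : a ≠ 0)
    (hN : IsNuclear v (ContinuousLinearMap.adjoint (weyl a)))
    (hT : ∀ z, IsNuclear v (ContinuousLinearMap.adjoint (weyl (translate z a)))) :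
    ∃ B : ℝ, 0 < B ∧ ∀ p q : ℝ≥0∞, 1 ≤ p → 1 ≤ q → ∀ ψ : M1dual v,
      ENNReal.ofReal B * modNorm hv p q m ψ ≤
        mixedNorm p q m (fun z => ‖extend hv (weyl (translate z a)) (hT z) ψ‖) := by
  have hS : ContinuousLinearMap.adjoint (weyl a) ≠ 0 := by
    rw [Ne, map_eq_zero_iff _ (LinearIsometryEquiv.injective _)]
    exact weyl_ne_zero ha
  obtain ⟨η, hη⟩ := DFunLike.ne_iff.1 hS
  obtain ⟨φ₁, hφ₁⟩ : ∃ φ₁ : M1 v, φ₁ = ⟨ContinuousLinearMap.adjoint (weyl a) η, hN.mem η⟩ :=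
    ⟨_, rfl⟩
  have hpos : 0 < ‖(φ₁ : L2 d)‖ := by
    rw [hφ₁]
    exact norm_pos_iff.2 hη
  obtain ⟨B, hB, hle⟩ := modNorm_le_of_window hv hm φ₁
  have hD0 : 0 < B * ‖η‖ + 1 := by positivity
  -- The estimates yield ‖φ₁‖² · (modulation norm) ≤ B‖η‖ · (operator norm expression). Replacing
  -- B‖η‖ by B‖η‖ + 1 permits the division, as B may be 0.
  refine ⟨(B * ‖η‖ + 1)⁻¹ * ‖(φ₁ : L2 d)‖ ^ 2, by positivity, fun p q hp hq ψ => ?_⟩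
  have hdual : ∀ z, ‖‖dualStft hv φ₁ ψ z‖‖ₑ ≤
      ‖η‖ₑ * ‖‖extend hv (weyl (translate z a)) (hT z) ψ‖‖ₑ := by
    intro z
    rw [hφ₁, enorm_norm, enorm_norm]
    exact enorm_dualStft_adjoint_weyl_le hv hT ψ η (hN.mem η) z
  have h1 := mixedNorm_le_const_mul p q m (enorm_ne_top (x := η)) hdual
  have h2 := hle p q hp hq ψ
  generalize mixedNorm p q m (fun z => ‖extend hv (weyl (translate z a)) (hT z) ψ‖) = N at h1 ⊢
  generalize mixedNorm p q m (fun z => ‖dualStft hv φ₁ ψ z‖) = M at h1 h2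
  generalize modNorm hv p q m ψ = M₀ at h2 ⊢
  have h3 : ‖(φ₁ : L2 d)‖ₑ ^ 2 * M₀ ≤ ENNReal.ofReal (B * ‖η‖ + 1) * N := by
    refine h2.trans ((mul_le_mul_right h1 _).trans ?_)
    rw [← mul_assoc, ← ofReal_norm, ← ENNReal.ofReal_mul hB]
    exact mul_le_mul_left (ENNReal.ofReal_le_ofReal (by linarith)) _
  rw [ENNReal.ofReal_mul (by positivity), ENNReal.ofReal_pow (norm_nonneg _), ofReal_norm,
    mul_assoc]
  refine (mul_le_mul_right h3 _).trans (le_of_eq ?_)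
  rw [← mul_assoc, ← ENNReal.ofReal_mul (by positivity), inv_mul_cancel₀ hD0.ne',
    ENNReal.ofReal_one, one_mul]

end

end TFA

theorem mainTheorem5 (d : ℕ) (v : TFA.E d × TFA.E d → ℝ) (hv : TFA.IsSubmultWeight v)
    (a : MeasureTheory.Lp ℂ 2 (MeasureTheory.volume : MeasureTheory.Measure (TFA.E d × TFA.E d)))
    (ha : a ≠ 0)
    (hN : TFA.IsNuclear v (ContinuousLinearMap.adjoint (TFA.weyl a))) :
    ∃ hT : ∀ z : TFA.E d × TFA.E d,
        TFA.IsNuclear v (ContinuousLinearMap.adjoint (TFA.weyl (TFA.translate z a))),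
      (∀ ψ : TFA.M1dual v, MeasureTheory.AEStronglyMeasurable
        (fun z => TFA.extend hv (TFA.weyl (TFA.translate z a)) (hT z) ψ)
        MeasureTheory.volume) ∧
      ∀ m : TFA.E d × TFA.E d → ℝ, TFA.IsModerate v m →
        ∃ C₁ C₂ : ℝ, 0 < C₁ ∧ 0 < C₂ ∧
          ∀ p q : ENNReal, 1 ≤ p → 1 ≤ q → ∀ ψ : TFA.M1dual v,
            ENNReal.ofReal C₁ * TFA.modNorm hv p q m ψ ≤
              TFA.mixedNorm p q m
                (fun z => ‖TFA.extend hv (TFA.weyl (TFA.translate z a)) (hT z) ψ‖) ∧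
            TFA.mixedNorm p q m
                (fun z => ‖TFA.extend hv (TFA.weyl (TFA.translate z a)) (hT z) ψ‖) ≤
              ENNReal.ofReal C₂ * TFA.modNorm hv p q m ψ := by
  obtain ⟨φ, ξ, hdec⟩ := hN
  have hD : TFA.IsNuclearDecomposition v (ContinuousLinearMap.adjoint (TFA.weyl a)) φ ξ := hdec
  have hT := fun z => (hD.translate hv z).isNuclear
  refine ⟨hT, fun ψ => hD.aestronglyMeasurable_extend hv hT ψ, fun m hm => ?_⟩
  obtain ⟨C₁, hC₁, h₁⟩ := TFA.le_mixedNorm_extend hv hm ha hD.isNuclear hT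
  obtain ⟨C₂, hC₂, h₂⟩ := hD.mixedNorm_extend_le hv hm hT
  exact ⟨C₁, C₂, hC₁, hC₂, fun p q hp hq ψ => ⟨h₁ p q hp hq ψ, h₂ p q hp hq ψ⟩⟩
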